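/- **Definitions.** Graphs are finite, simple and undirected, possibly disconnected. A set $M\subseteq V_G$ is a module of $G$ if any two vertices of $M$ have the same neighbours outside $M$. An independent module-sequence of $G$ is a bijection $\varphi:V_G\to\{1,\dots,|V_G|\}$ such that for every $2\le i\le |V_G|$ the neighbourhood of $\varphi^{-1}(i)$ in the induced subgraph $G[\{\varphi^{-1}(1),\dots,\varphi^{-1}(i-1)\}]$ is a module of that subgraph and an independent set. $G$ is independent module-composed if it has an independent module-sequence. A BFS numbering of $G$ is a numbering of the vertices in which the next vertex is always an unnumbered neighbour of the earliest numbered vertex that still has an unnumbered neighbour (and an arbitrary unnumbered vertex if there is no such vertex). The first numbered vertex of each connected component is the start vertex of that component, and the levels of the numbering are the sets $N_k(u)=\{v: v \text{ is at distance } k \text{ from } u\}$ for all start vertices $u$ and all $k\ge 0$. The machine model is a random access machine with finitely many registers and arrays of natural numbers, initially $0$ outside the input, with indirect addressing of array cells, comparisons of registers, and as arithmetic only the addition and subtraction of $1$ (so that in linear time all numbers stay linear in the size of the input); each instruction and each test costs one step. A graph with $V_G=\{0,\dots,n-1\}$ is given by $n$ and by its adjacency lists, each in arbitrary order, stored consecutively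 in an array together with their boundaries. **Theorem.** There are a program for this machine and a constant $C$ such that on every graph $G$ the program halts after at most $C\,(|V_G|+|E_G|+1)$ steps and 1. answers correctly whether $G$ is independent module-composed; 2. outputs a BFS numbering $\varphi$ of $G$ and, for every vertex, the index $k$ of the level $N_k(u)$ of $\varphi$ that contains it; 3. if $G$ is independent module-composed, outputs an independent module-sequence $\psi$ of $G$ which arises from $\varphi$ by rearranging every level $N_k(u)$ within the positions that it occupies, in such a way that $\psi(v)<\psi(w)$ whenever $v,w\in N_k(u)$, $k\ge1$, and $N(w)\cap N_{k-1}(u)\subsetneq N(v)\cap N_{k-1}(u)$. -/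

import Mathlib

/-! ## Modules and independent module-sequences -/

/-- `M` is a module (homogeneous set) of `G`: any two of its vertices have the same
neighbours outside `M`. -/
def IsModule {V : Type*} (G : SimpleGraph V) (M : Set V) : Prop :=
  ∀ v₁ ∈ M, ∀ v₂ ∈ M, G.neighborSet v₁ \ M = G.neighborSet v₂ \ M

/-- `φ` numbers the vertices of `G` in such a way that the neighbourhood of each vertex after the
first one, in the subgraph induced by the vertices with smaller numbers, is a module of that
subgraph and an independent set. Positions are counted from `0`. -/
def IsIndependentModuleSequence {V : Type*} (G : SimpleGraph V) {k : ℕ} (φ : V ≃ Fin k) : Prop :=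
  ∀ v : V, 1 ≤ (φ v : ℕ) →
    IsModule (G.induce {x | φ x < φ v}) {x | G.Adj v x} ∧
      (G.induce {x | φ x < φ v}).IsIndepSet {x | G.Adj v x}

def IsIndependentModuleComposed {V : Type*} [Fintype V] (G : SimpleGraph V) : Prop :=
  ∃ φ : V ≃ Fin (Fintype.card V), IsIndependentModuleSequence G φ

/-! ## Breadth first search -/

/-- Breadth first numbering (of a possibly disconnected graph): whenever a vertex `b` receives its
number, it is a neighbour of the earliest numbered vertex `a` that still has an unnumbered
neighbour `c` (`b` itself counts as unnumbered at that moment). If no numbered vertex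
has an unnumbered neighbour, `b` is arbitrary and starts a new connected component. -/
def IsBFSNumbering {V : Type*} (G : SimpleGraph V) {k : ℕ} (φ : V ≃ Fin k) : Prop :=
  ∀ a b c : V, φ a < φ b → φ b ≤ φ c → G.Adj a c →
    (∀ d e : V, φ d < φ a → φ b ≤ φ e → ¬ G.Adj d e) → G.Adj a b

/-- `u` is the first vertex of its connected component with respect to `φ`, i.e. the vertex from
which the search explores that component. -/
def IsStartVertex {V : Type*} (G : SimpleGraph V) {k : ℕ} (φ : V ≃ Fin k) (u : V) : Prop :=
  ∀ w : V, G.Reachable u w → φ u ≤ φ w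

/-- The level `N_k(u)`: the vertices at distance `k` from `u`. -/
def levelSet {V : Type*} (G : SimpleGraph V) (u : V) (k : ℕ) : Set V :=
  {v | G.Reachable u v ∧ G.dist u v = k}

/-- `ψ` arises from the numbering `φ` by permuting, for each start vertex `u` of `φ` and each `k`,
the vertices of the level `N_k(u)` among the positions they occupy in `φ`. -/
def IsLevelRearrangement {V : Type*} (G : SimpleGraph V) {n : ℕ} (φ ψ : V ≃ Fin n) : Prop :=
  ∀ u : V, IsStartVertex G φ u → ∀ k : ℕ, ψ '' levelSet G u k = φ '' levelSet G u k

/-- In `ψ` every level `N_{k+1}(u)`, for `u` a start vertex of `φ`, is sorted by decreasing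
neighbourhood in the previous level: a vertex whose neighbourhood in `N_k(u)` properly contains
that of another one comes first. -/
def IsSortedByInclusion {V : Type*} (G : SimpleGraph V) {n : ℕ} (φ ψ : V ≃ Fin n) : Prop :=
  ∀ u : V, IsStartVertex G φ u → ∀ k : ℕ, ∀ v ∈ levelSet G u (k + 1), ∀ w ∈ levelSet G u (k + 1),
    G.neighborSet w ∩ levelSet G u k ⊂ G.neighborSet v ∩ levelSet G u k → ψ v < ψ w

/-! ## Random access machine programs with unit cost

A program uses finitely many registers and arrays, all holding natural numbers. The arithmetic is
limited to adding and subtracting `1`, so that `t` steps increase the largest number in memory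
by at most `t` (or to at most `t` above a constant of the program): numbers have `O(log)` of the
running time plus input size many bits, and unit cost is realistic. -/

namespace Ram

/-- The memory: the registers and, for each array name, the cells of that array. -/
structure Memory where
  reg : ℕ → ℕ
  arr : ℕ → ℕ → ℕ

/-- Tests compare two registers. -/
inductive Test where
  | eq (r s : ℕ)
  | lt (r s : ℕ)

def Test.Holds : Test → Memory → Prop
  | .eq r s, σ => σ.reg r = σ.reg s
  | .lt r s, σ => σ.reg r < σ.reg s

def Memory.setReg (σ : Memory) (r x : ℕ) : Memory :=
  { σ with reg := Function.update σ.reg r x }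

def Memory.setCell (σ : Memory) (a i x : ℕ) : Memory :=
  { σ with arr := Function.update σ.arr a (Function.update (σ.arr a) i x) }

/-- Programs. The names of registers and arrays are fixed in the program text, while
array cells are addressed indirectly through the content of a register. -/
inductive Program where
  /-- no operation -/
  | skip
  /-- `r := c` for a constant `c` -/
  | const (r c : ℕ)
  /-- `r := s` -/
  | copy (r s : ℕ)
  /-- `r := s + 1` -/
  | succ (r s : ℕ)
  /-- `r := s - 1`, where `0 - 1 = 0` -/
  | pred (r s : ℕ)
  /-- `r := a[s]` -/
  | load (r a s : ℕ)
  /-- `a[r] := s` -/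
  | store (a r s : ℕ)
  | seq (p q : Program)
  | ite (b : Test) (p q : Program)
  | loop (b : Test) (p : Program)

/-- `Exec p σ t τ`: the program `p`, started in memory `σ`, terminates after exactly `t` steps in
memory `τ`. Every elementary instruction and every evaluation of a test is one step;
`loop b p` repeats `p` while `b` holds. -/
inductive Exec : Program → Memory → ℕ → Memory → Prop
  | skip (σ : Memory) : Exec .skip σ 1 σ
  | const (r c : ℕ) (σ : Memory) : Exec (.const r c) σ 1 (σ.setReg r c)
  | copy (r s : ℕ) (σ : Memory) : Exec (.copy r s) σ 1 (σ.setReg r (σ.reg s))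
  | succ (r s : ℕ) (σ : Memory) : Exec (.succ r s) σ 1 (σ.setReg r (σ.reg s + 1))
  | pred (r s : ℕ) (σ : Memory) : Exec (.pred r s) σ 1 (σ.setReg r (σ.reg s - 1))
  | load (r a s : ℕ) (σ : Memory) : Exec (.load r a s) σ 1 (σ.setReg r (σ.arr a (σ.reg s)))
  | store (a r s : ℕ) (σ : Memory) :
      Exec (.store a r s) σ 1 (σ.setCell a (σ.reg r) (σ.reg s))
  | seq {p q : Program} {σ τ ρ : Memory} {t t' : ℕ} :
      Exec p σ t τ → Exec q τ t' ρ → Exec (.seq p q) σ (t + t') ρ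
  | ite_true {b : Test} {p q : Program} {σ τ : Memory} {t : ℕ} :
      b.Holds σ → Exec p σ t τ → Exec (.ite b p q) σ (t + 1) τ
  | ite_false {b : Test} {p q : Program} {σ τ : Memory} {t : ℕ} :
      ¬ b.Holds σ → Exec q σ t τ → Exec (.ite b p q) σ (t + 1) τ
  | loop_false {b : Test} {p : Program} {σ : Memory} :
      ¬ b.Holds σ → Exec (.loop b p) σ 1 σ
  | loop_true {b : Test} {p : Program} {σ τ ρ : Memory} {t t' : ℕ} :
      b.Holds σ → Exec p σ t τ → Exec (.loop b p) τ t' ρ → Exec (.loop b p) σ (t + t' + 1) ρ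

end Ram

/-! ## Input and output -/

/-- `L` is an adjacency list representation of `G`: `L v` lists the neighbours of `v`, each of
them once, in an arbitrary order. -/
def IsAdjacencyLists {n : ℕ} (G : SimpleGraph (Fin n)) (L : Fin n → List (Fin n)) : Prop :=
  ∀ v : Fin n, (L v).Nodup ∧ ∀ w : Fin n, w ∈ L v ↔ G.Adj v w

/-- The initial memory. Register `0` holds the number `n` of vertices, array `1` holds the
concatenation of the adjacency lists, and array `0` their boundaries: the list of `v` occupies
the cells of array `1` from index `arr 0 v` up to, but excluding, index `arr 0 (v + 1)`. All
other registers and cells are `0`. -/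
def inputMemory {n : ℕ} (L : Fin n → List (Fin n)) : Ram.Memory where
  reg := fun r => if r = 0 then n else 0
  arr := fun a i =>
    if a = 0 then (if i ≤ n then ((List.ofFn L).take i).flatten.length else 0)
    else if a = 1 then ((List.ofFn L).flatten.map Fin.val).getD i 0
    else 0

/-- The array `a` holds the numbering `φ`: its cell `i` contains the vertex with number `i`. -/
def HoldsNumbering {n : ℕ} (σ : Ram.Memory) (a : ℕ) (φ : Fin n ≃ Fin n) : Prop :=
  ∀ i : Fin n, σ.arr a i = (φ.symm i : ℕ)

/-- The array `a` holds the levels with respect to the start vertices of `φ`. -/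
def HoldsLevels {n : ℕ} (G : SimpleGraph (Fin n)) (σ : Ram.Memory) (a : ℕ)
    (φ : Fin n ≃ Fin n) : Prop :=
  ∀ u : Fin n, IsStartVertex G φ u → ∀ k : ℕ, ∀ v ∈ levelSet G u k, σ.arr a v = k

namespace Ram

/-! ## Reasoning about programs -/

def Program.writesReg : Program → ℕ → Bool
  | .skip, _ => false
  | .const r _, x => r == x
  | .copy r _, x => r == x
  | .succ r _, x => r == x
  | .pred r _, x => r == x
  | .load r _ _, x => r == x
  | .store _ _ _, _ => false
  | .seq p q, x => p.writesReg x || q.writesReg x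
  | .ite _ p q, x => p.writesReg x || q.writesReg x
  | .loop _ p, x => p.writesReg x

def Program.writesArr : Program → ℕ → Bool
  | .skip, _ => false
  | .const _ _, _ => false
  | .copy _ _, _ => false
  | .succ _ _, _ => false
  | .pred _ _, _ => false
  | .load _ _ _, _ => false
  | .store a _ _, x => a == x
  | .seq p q, x => p.writesArr x || q.writesArr x
  | .ite _ p q, x => p.writesArr x || q.writesArr x
  | .loop _ p, x => p.writesArr x

theorem Memory.reg_setReg (σ : Memory) (r x s : ℕ) :
    (σ.setReg r x).reg s = if s = r then x else σ.reg s := by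
  simp [Memory.setReg, Function.update_apply]

theorem Memory.arr_setReg (σ : Memory) (r x a : ℕ) : (σ.setReg r x).arr a = σ.arr a := rfl

theorem Memory.reg_setCell (σ : Memory) (a i x s : ℕ) : (σ.setCell a i x).reg s = σ.reg s := rfl

theorem Memory.arr_setCell (σ : Memory) (a i x b : ℕ) :
    (σ.setCell a i x).arr b = if b = a then Function.update (σ.arr b) i x else σ.arr b := by
  by_cases h : b = a
  · subst h; simp [Memory.setCell]
  · simp [Memory.setCell, h]

/-- The memories `σ` and `τ` agree on everything that the program `p` never writes. -/
structure Agree (p : Program) (σ τ : Memory) : Prop where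
  reg : ∀ r, p.writesReg r = false → τ.reg r = σ.reg r
  arr : ∀ a, p.writesArr a = false → τ.arr a = σ.arr a

theorem Agree.refl (p : Program) (σ : Memory) : Agree p σ σ := ⟨fun _ _ => rfl, fun _ _ => rfl⟩

theorem Agree.trans {p : Program} {σ τ ρ : Memory} (h : Agree p σ τ) (h' : Agree p τ ρ) :
    Agree p σ ρ :=
  ⟨fun r hr => (h'.reg r hr).trans (h.reg r hr),
    fun a ha => (h'.arr a ha).trans (h.arr a ha)⟩

theorem Agree.weaken {p q : Program} {σ τ : Memory} (h : Agree p σ τ)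
    (hr : ∀ r, q.writesReg r = false → p.writesReg r = false)
    (ha : ∀ r, q.writesArr r = false → p.writesArr r = false) : Agree q σ τ :=
  ⟨fun r h' => h.reg r (hr r h'), fun a h' => h.arr a (ha a h')⟩

theorem Exec.agree {p : Program} {σ τ : Memory} {t : ℕ} (h : Exec p σ t τ) : Agree p σ τ := by
  induction h with
  | skip σ => exact .refl _ _
  | const | copy | succ | pred | load =>
    refine ⟨fun x hx => ?_, fun _ _ => rfl⟩
    simp only [Program.writesReg, beq_eq_false_iff_ne] at hx
    simp only [Memory.reg_setReg, if_neg hx.symm]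
  | store =>
    refine ⟨fun _ _ => rfl, fun x hx => ?_⟩
    simp only [Program.writesArr, beq_eq_false_iff_ne] at hx
    simp [Memory.arr_setCell, hx.symm]
  | seq _ _ ih ih' =>
    refine (ih.weaken ?_ ?_).trans (ih'.weaken ?_ ?_) <;>
      simp +contextual [Program.writesReg, Program.writesArr]
  | ite_true _ _ ih | ite_false _ _ ih =>
    refine ih.weaken ?_ ?_ <;> simp +contextual [Program.writesReg, Program.writesArr]
  | loop_false => exact .refl _ _
  | loop_true _ _ _ ih ih' =>
    refine (ih.weaken ?_ ?_).trans ih' <;>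
      simp +contextual [Program.writesReg, Program.writesArr]

/-- The program `p`, started in `σ`, terminates, and its running time and final memory
satisfy `Q`. -/
def Wp (p : Program) (σ : Memory) (Q : ℕ → Memory → Prop) : Prop :=
  ∃ t τ, Exec p σ t τ ∧ Q t τ

theorem Wp.mono {p : Program} {σ : Memory} {Q R : ℕ → Memory → Prop} (h : Wp p σ Q)
    (hQ : ∀ t τ, Agree p σ τ → Q t τ → R t τ) : Wp p σ R := by
  obtain ⟨t, τ, he, hq⟩ := h
  exact ⟨t, τ, he, hQ t τ he.agree hq⟩

theorem wp_skip_iff {σ : Memory} {Q : ℕ → Memory → Prop} : Wp .skip σ Q ↔ Q 1 σ :=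
  ⟨fun ⟨_, _, h, hq⟩ => by cases h; exact hq, fun h => ⟨_, _, .skip σ, h⟩⟩

theorem wp_const_iff {r c : ℕ} {σ : Memory} {Q : ℕ → Memory → Prop} :
    Wp (.const r c) σ Q ↔ Q 1 (σ.setReg r c) :=
  ⟨fun ⟨_, _, h, hq⟩ => by cases h; exact hq, fun h => ⟨_, _, .const r c σ, h⟩⟩

theorem wp_copy_iff {r s : ℕ} {σ : Memory} {Q : ℕ → Memory → Prop} :
    Wp (.copy r s) σ Q ↔ Q 1 (σ.setReg r (σ.reg s)) :=
  ⟨fun ⟨_, _, h, hq⟩ => by cases h; exact hq, fun h => ⟨_, _, .copy r s σ, h⟩⟩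

theorem wp_succ_iff {r s : ℕ} {σ : Memory} {Q : ℕ → Memory → Prop} :
    Wp (.succ r s) σ Q ↔ Q 1 (σ.setReg r (σ.reg s + 1)) :=
  ⟨fun ⟨_, _, h, hq⟩ => by cases h; exact hq, fun h => ⟨_, _, .succ r s σ, h⟩⟩

theorem wp_pred_iff {r s : ℕ} {σ : Memory} {Q : ℕ → Memory → Prop} :
    Wp (.pred r s) σ Q ↔ Q 1 (σ.setReg r (σ.reg s - 1)) :=
  ⟨fun ⟨_, _, h, hq⟩ => by cases h; exact hq, fun h => ⟨_, _, .pred r s σ, h⟩⟩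

theorem wp_load_iff {r a s : ℕ} {σ : Memory} {Q : ℕ → Memory → Prop} :
    Wp (.load r a s) σ Q ↔ Q 1 (σ.setReg r (σ.arr a (σ.reg s))) :=
  ⟨fun ⟨_, _, h, hq⟩ => by cases h; exact hq, fun h => ⟨_, _, .load r a s σ, h⟩⟩

theorem wp_store_iff {a r s : ℕ} {σ : Memory} {Q : ℕ → Memory → Prop} :
    Wp (.store a r s) σ Q ↔ Q 1 (σ.setCell a (σ.reg r) (σ.reg s)) :=
  ⟨fun ⟨_, _, h, hq⟩ => by cases h; exact hq, fun h => ⟨_, _, .store a r s σ, h⟩⟩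

theorem wp_seq_iff {p q : Program} {σ : Memory} {Q : ℕ → Memory → Prop} :
    Wp (.seq p q) σ Q ↔ Wp p σ fun t τ => Wp q τ fun t' ρ => Q (t + t') ρ := by
  constructor
  · rintro ⟨_, _, h, hq⟩
    cases h with
    | seq h h' => exact ⟨_, _, h, _, _, h', hq⟩
  · rintro ⟨_, _, h, _, _, h', hq⟩
    exact ⟨_, _, .seq h h', hq⟩

theorem wp_ite_iff {b : Test} {p q : Program} {σ : Memory} {Q : ℕ → Memory → Prop} :
    Wp (.ite b p q) σ Q ↔ (b.Holds σ → Wp p σ fun t τ => Q (t + 1) τ) ∧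
      (¬ b.Holds σ → Wp q σ fun t τ => Q (t + 1) τ) := by
  constructor
  · rintro ⟨_, _, h, hq⟩
    cases h with
    | ite_true hb h => exact ⟨fun _ => ⟨_, _, h, hq⟩, fun h => absurd hb h⟩
    | ite_false hb h => exact ⟨fun h => absurd h hb, fun _ => ⟨_, _, h, hq⟩⟩
  · rintro ⟨h, h'⟩
    by_cases hb : b.Holds σ
    · obtain ⟨_, _, h, hq⟩ := h hb
      exact ⟨_, _, .ite_true hb h, hq⟩
    · obtain ⟨_, _, h, hq⟩ := h' hb
      exact ⟨_, _, .ite_false hb h, hq⟩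

/-- Loops are analysed with an invariant `I` and a potential `Φ` that pays for the steps. -/
theorem Wp.loop {b : Test} {p : Program} (I : Memory → Prop) (Φ : Memory → ℕ) {σ : Memory}
    (step : ∀ ρ, Agree p σ ρ → I ρ → b.Holds ρ →
      Wp p ρ fun t τ => I τ ∧ Φ τ + t + 1 ≤ Φ ρ)
    (start : I σ) :
    Wp (.loop b p) σ fun t τ => t ≤ Φ σ + 1 ∧ I τ ∧ ¬ b.Holds τ := by
  have key : ∀ k ρ, Φ ρ = k → Agree p σ ρ → I ρ →
      Wp (.loop b p) ρ fun t τ => t ≤ Φ ρ + 1 ∧ I τ ∧ ¬ b.Holds τ := by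
    intro k
    induction k using Nat.strong_induction_on with
    | _ k ih =>
      intro ρ hk ha hI
      by_cases hb : b.Holds ρ
      · obtain ⟨t, τ, he, hI', hΦ⟩ := step ρ ha hI hb
        obtain ⟨t', τ', he', ht', hI'', hb'⟩ := ih (Φ τ) (by omega) τ rfl (ha.trans he.agree) hI'
        exact ⟨_, _, .loop_true hb he he', by omega, hI'', hb'⟩
      · exact ⟨_, _, .loop_false hb, by omega, hI, hb⟩
  exact key _ σ rfl (.refl _ _) start

/-- `for i := 0` up to, but excluding, the content of register `0`. -/
def forUpTo (i : ℕ) (p : Program) : Program :=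
  .seq (.const i 0) (.loop (.lt i 0) (.seq p (.succ i i)))

theorem wp_forUpTo {i : ℕ} {p : Program} (I : ℕ → Memory → Prop) (c : ℕ → ℕ) {σ : Memory}
    (hi : p.writesReg i = false) (h0 : p.writesReg 0 = false) (hi0 : i ≠ 0)
    (stable : ∀ k ρ x, I k ρ → I k (ρ.setReg i x))
    (step : ∀ k < σ.reg 0, ∀ ρ, Agree (forUpTo i p) σ ρ → ρ.reg i = k → I k ρ →
      Wp p ρ fun t τ => t ≤ c k ∧ I (k + 1) τ)
    (start : I 0 σ) :
    Wp (forUpTo i p) σ fun t τ =>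
      t ≤ ∑ k ∈ Finset.range (σ.reg 0), (c k + 2) + 2 ∧ I (σ.reg 0) τ := by
  rw [forUpTo, wp_seq_iff, wp_const_iff]
  have hw : (Program.loop (.lt i 0) (.seq p (.succ i i))).writesReg 0 = false := by
    simp [Program.writesReg, h0, hi0]
  refine (Wp.loop (fun ρ => ρ.reg i ≤ σ.reg 0 ∧ I (ρ.reg i) ρ)
    (fun ρ => ∑ k ∈ Finset.Ico (ρ.reg i) (σ.reg 0), (c k + 2)) ?_ ?_).mono ?_
  · rintro ρ ha ⟨-, hI⟩ hb
    have e0 : ρ.reg 0 = σ.reg 0 := by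
      rw [ha.reg 0 hw, Memory.reg_setReg, if_neg hi0.symm]
    have hlt : ρ.reg i < σ.reg 0 := e0 ▸ hb
    have ha' : Agree (forUpTo i p) σ ρ := by
      refine Agree.trans (τ := σ.setReg i 0) ⟨fun r hr => ?_, fun _ _ => rfl⟩ (ha.weaken ?_ ?_)
      · simp [forUpTo, Program.writesReg] at hr
        simp [Memory.reg_setReg, Ne.symm hr.1]
      · simp +contextual [forUpTo, Program.writesReg]
      · simp +contextual [forUpTo, Program.writesArr]
    rw [wp_seq_iff]
    refine (step _ hlt ρ ha' rfl hI).mono fun t τ hag ⟨ht, hI'⟩ => ?_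
    rw [wp_succ_iff]
    have ei : τ.reg i = ρ.reg i := hag.reg i hi
    simp only [Memory.reg_setReg, if_true, ei]
    refine ⟨⟨hlt, stable _ _ _ hI'⟩, ?_⟩
    rw [Finset.sum_eq_sum_Ico_succ_bot hlt]
    omega
  · simpa [Memory.reg_setReg] using stable _ _ _ start
  · rintro t τ ha ⟨ht, ⟨hle, hI⟩, hb⟩
    have e0 : τ.reg 0 = σ.reg 0 := by
      rw [ha.reg 0 hw, Memory.reg_setReg, if_neg hi0.symm]
    have : τ.reg i = σ.reg 0 := by
      simp only [Test.Holds, e0] at hb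
      omega
    rw [this] at hI
    refine ⟨?_, hI⟩
    simp only [Memory.reg_setReg, if_true, Finset.range_eq_Ico] at ht ⊢
    omega

/-- `σ` stores the adjacency lists `N v`, `v < n`, in the format of the input. -/
def HoldsAdjacency (σ : Memory) (n : ℕ) (N : ℕ → List ℕ) : Prop :=
  ∀ v < n, σ.arr 0 (v + 1) = σ.arr 0 v + (N v).length ∧
    ∀ i (h : i < (N v).length), σ.arr 1 (σ.arr 0 v + i) = (N v)[i]

/-- Run `p` for every neighbour of the vertex in register `v`; the neighbour is
in register `21`. -/
def forNeighbors (v : ℕ) (p : Program) : Program :=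
  .seq (.load 20 0 v) (.seq (.succ 22 v) (.seq (.load 22 0 22)
    (.loop (.lt 20 22) (.seq (.load 21 1 20) (.seq p (.succ 20 20))))))

theorem wp_forNeighbors {v c x n : ℕ} {N : ℕ → List ℕ} {p : Program}
    (I : List ℕ → Memory → Prop) {σ : Memory}
    (hN : HoldsAdjacency σ n N) (hv : σ.reg v = x) (hx : x < n)
    (h20 : p.writesReg 20 = false) (h22 : p.writesReg 22 = false)
    (ha1 : p.writesArr 1 = false)
    (hv20 : v ≠ 20)
    (stable : ∀ l ρ r y, r = 20 ∨ r = 21 ∨ r = 22 → I l ρ → I l (ρ.setReg r y))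
    (step : ∀ l w l', N x = l ++ w :: l' → ∀ ρ, Agree (forNeighbors v p) σ ρ →
      ρ.reg 21 = w → I l ρ → Wp p ρ fun t τ => t ≤ c ∧ I (l ++ [w]) τ)
    (start : I [] σ) :
    Wp (forNeighbors v p) σ fun t τ => t ≤ (c + 3) * (N x).length + 4 ∧ I (N x) τ := by
  obtain ⟨hlen, hget⟩ := hN x hx
  simp only [forNeighbors, wp_seq_iff, wp_load_iff, wp_succ_iff]
  set σ' := ((σ.setReg 20 (σ.arr 0 (σ.reg v))).setReg 22
    ((σ.setReg 20 (σ.arr 0 (σ.reg v))).reg v + 1)) with hσ'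
  set σ₁ := σ'.setReg 22 (σ'.arr 0 (σ'.reg 22)) with hσ₁
  have e20 : σ₁.reg 20 = σ.arr 0 x := by
    simp [hσ₁, hσ', Memory.reg_setReg, hv]
  have e22 : σ₁.reg 22 = σ.arr 0 x + (N x).length := by
    simp [hσ₁, hσ', Memory.reg_setReg, Memory.arr_setReg, hv, hv20, hlen]
  have earr : σ₁.arr = σ.arr := rfl
  have hw22 : (Program.loop (.lt 20 22) (.seq (.load 21 1 20) (.seq p (.succ 20 20)))).writesReg 22
      = false := by simp [Program.writesReg, h22]
  refine (Wp.loop (fun ρ => ∃ l l', N x = l ++ l' ∧ ρ.reg 20 = σ.arr 0 x + l.length ∧ I l ρ)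
    (fun ρ => (c + 3) * (σ.arr 0 x + (N x).length - ρ.reg 20)) ?_ ?_).mono ?_
  · rintro ρ ha ⟨l, l', hl, hr, hI⟩ hb
    have hr22 : ρ.reg 22 = σ.arr 0 x + (N x).length := (ha.reg 22 hw22).trans e22
    have hb' : l.length < (N x).length := by
      simp only [Test.Holds, hr22, hr] at hb; omega
    obtain _ | ⟨w, l'⟩ := l'
    · simp [hl] at hb'
    have ha' : Agree (forNeighbors v p) σ ρ := by
      refine Agree.trans (τ := σ₁) ⟨fun r hr => ?_, fun _ _ => rfl⟩ (ha.weaken ?_ ?_)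
      · simp [forNeighbors, Program.writesReg] at hr
        have h1 := Ne.symm hr.1
        have h2 := Ne.symm hr.2.1
        simp [hσ₁, hσ', Memory.reg_setReg, h1, h2]
      · simp +contextual [forNeighbors, Program.writesReg]
      · simp +contextual [forNeighbors, Program.writesArr]
    have hw : ρ.arr 1 (ρ.reg 20) = w := by
      rw [ha'.arr 1 (by simp [forNeighbors, Program.writesArr, ha1]), hr, hget _ hb']
      simp [hl]
    rw [wp_seq_iff, wp_load_iff, hw, wp_seq_iff]
    have ha'' : Agree (forNeighbors v p) σ (ρ.setReg 21 w) := by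
      refine ha'.trans ⟨fun r hr => ?_, fun _ _ => rfl⟩
      simp [forNeighbors, Program.writesReg] at hr
      simp [Memory.reg_setReg, Ne.symm hr.2.2.1]
    refine (step l w l' hl _ ha'' (by simp [Memory.reg_setReg])
      (stable _ _ _ _ (by simp) hI)).mono fun t τ hag ⟨ht, hI'⟩ => ?_
    rw [wp_succ_iff]
    have e : τ.reg 20 = ρ.reg 20 := by
      rw [hag.reg 20 h20]; simp [Memory.reg_setReg]
    refine ⟨⟨l ++ [w], l', by simp [hl], ?_, stable _ _ _ _ (by simp) hI'⟩, ?_⟩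
    · simp [Memory.reg_setReg, e, hr]; omega
    · simp only [Memory.reg_setReg, if_true, e, hr]
      obtain ⟨d, hd⟩ : ∃ d, σ.arr 0 x + (N x).length - (σ.arr 0 x + l.length) = d + 1 :=
        ⟨_, (Nat.succ_pred_eq_of_pos (by omega)).symm⟩
      rw [hd, show σ.arr 0 x + (N x).length - (σ.arr 0 x + l.length + 1) = d by omega]
      ring_nf
      omega
  · exact ⟨[], N x, rfl, by simp [e20], stable _ _ _ _ (by simp)
      (stable _ _ _ _ (by simp) (stable _ _ _ _ (by simp) start))⟩
  · rintro t τ ha ⟨ht, ⟨l, l', hl, hr, hI⟩, hb⟩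
    have hr22 : τ.reg 22 = σ.arr 0 x + (N x).length := (ha.reg 22 hw22).trans e22
    have : l' = [] := by
      simp only [Test.Holds, hr22, hr, hl, List.length_append] at hb
      exact List.eq_nil_of_length_eq_zero (by omega)
    subst this
    rw [List.append_nil] at hl
    rw [e20] at ht
    refine ⟨?_, hl ▸ hI⟩
    rw [Nat.add_sub_cancel_left] at ht
    omega

end Ram

/-! ## Independent module-sequences as orders with twin neighbourhoods -/

section GraphTheory

variable {V : Type*} {G : SimpleGraph V} {n : ℕ}

theorem isIndependentModuleSequence_iff {φ : V ≃ Fin n} :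
    IsIndependentModuleSequence G φ ↔ ∀ a b c d, φ b < φ a → φ c < φ a → φ d < φ a →
      G.Adj a b → G.Adj a c → G.Adj b d → G.Adj c d := by
  constructor
  · intro h a b c d hb hc hd hab hac hbd
    obtain ⟨hm, hi⟩ := h a (by have : (φ b : ℕ) < φ a := hb; omega)
    by_cases had : G.Adj a d
    · by_cases hbd' : b = d
      · exact absurd hbd (hbd' ▸ G.irrefl)
      · exact absurd hbd (hi (x := ⟨b, hb⟩) hab (y := ⟨d, hd⟩) had (by simpa using hbd'))
    · have := hm ⟨b, hb⟩ hab ⟨c, hc⟩ hac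
      have hd' : (⟨d, hd⟩ : {x | φ x < φ a}) ∈
          (G.induce {x | φ x < φ a}).neighborSet ⟨b, hb⟩ \ {x | G.Adj a x} := ⟨hbd, had⟩
      rw [this] at hd'
      exact hd'.1
  · intro h a _
    refine ⟨?_, ?_⟩
    · have key : ∀ v₁ ∈ {x : {x | φ x < φ a} | G.Adj a x}, ∀ v₂ ∈ {x : {x | φ x < φ a} | G.Adj a x},
          (G.induce {x | φ x < φ a}).neighborSet v₁ \ {x | G.Adj a x} ⊆
          (G.induce {x | φ x < φ a}).neighborSet v₂ \ {x | G.Adj a x} :=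
        fun v₁ h₁ v₂ h₂ d hd => ⟨h a v₁ v₂ d v₁.2 v₂.2 d.2 h₁ h₂ hd.1, hd.2⟩
      exact fun v₁ h₁ v₂ h₂ => (key v₁ h₁ v₂ h₂).antisymm (key v₂ h₂ v₁ h₁)
    · intro x hx y hy _ hxy
      exact G.irrefl (h a x y y x.2 y.2 y.2 hx hy hxy)

/-- The neighbours of a vertex `a` with smaller number are twins before `a`. -/
def IsTwinOrder (G : SimpleGraph V) (o : V → ℕ) : Prop :=
  ∀ a b c d, o b ≤ o a → o c ≤ o a → o d ≤ o a →
    G.Adj a b → G.Adj a c → G.Adj b d → G.Adj c d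

theorem IsIndependentModuleSequence.isTwinOrder {φ : V ≃ Fin n}
    (h : IsIndependentModuleSequence G φ) : IsTwinOrder G fun v => φ v := by
  rw [isIndependentModuleSequence_iff] at h
  intro a b c d hb hc hd hab hac hbd
  have lt : ∀ x, (φ x : ℕ) ≤ φ a → x ≠ a → φ x < φ a := fun x hx hne =>
    lt_of_le_of_ne hx fun e => hne (φ.injective e)
  by_cases hda : d = a
  · exact hda ▸ hac.symm
  · exact h a b c d (lt b hb hab.ne') (lt c hc hac.ne') (lt d hd hda) hab hac hbd

/-- A path whose vertices lie on consecutive levels. -/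
structure IsAscending (G : SimpleGraph V) (lev : V → ℕ) (f : ℕ → V) (k : ℕ) : Prop where
  adj : ∀ i < k, G.Adj (f i) (f (i + 1))
  lev : ∀ i ≤ k, lev (f i) = lev (f 0) + i

namespace IsAscending

variable {lev : V → ℕ} {f g : ℕ → V} {k : ℕ}

theorem tail (h : IsAscending G lev f (k + 1)) : IsAscending G lev (fun i => f (i + 1)) k :=
  ⟨fun i hi => h.adj (i + 1) (by omega), fun i hi => by
    have h1 := h.lev (i + 1) (by omega)
    have h2 := h.lev (0 + 1) (by omega)
    omega⟩

theorem tail_update (h : IsAscending G lev g (k + 2)) {x : V} (hx : lev x = lev (g 0) + 1)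
    (hadj : G.Adj x (g 2)) :
    IsAscending G lev (fun i => if i = 0 then x else g (i + 1)) (k + 1) := by
  refine ⟨fun i hi => ?_, fun i hi => ?_⟩
  · rcases i with _ | i
    · simpa using hadj
    · simpa using h.adj (i + 2) (by omega)
  · rcases i with _ | i
    · simp
    · have := h.lev (i + 1 + 1) (by omega)
      simp only [Nat.add_eq_zero_iff, one_ne_zero, and_false, if_false, if_true]
      omega

theorem extend (h : IsAscending G lev f k) {x : V} (hx : G.Adj (f k) x)
    (hl : lev x = lev (f 0) + (k + 1)) :
    IsAscending G lev (fun i => if i ≤ k then f i else x) (k + 1) := by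
  refine ⟨fun i hi => ?_, fun i hi => ?_⟩
  · rcases Nat.lt_or_ge i k with hik | hik
    · simpa [hik.le, Nat.succ_le_of_lt hik] using h.adj i hik
    · obtain rfl : i = k := by omega
      simpa using hx
  · by_cases hik : i ≤ k
    · simpa [hik] using h.lev i hik
    · obtain rfl : i = k + 1 := by omega
      simpa [hik] using hl

end IsAscending

/-- An index at which one of two sequences takes the largest value. -/
theorem exists_max_index (o : V → ℕ) (f g : ℕ → V) (k : ℕ) :
    ∃ i ≤ k, (∀ j ≤ k, o (f j) ≤ o (f i) ∧ o (g j) ≤ o (f i)) ∨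
      (∀ j ≤ k, o (g j) ≤ o (g i) ∧ o (f j) ≤ o (g i)) := by
  obtain ⟨i, hi, hmax⟩ := Finset.exists_max_image (Finset.range (k + 1))
    (fun i => max (o (f i)) (o (g i))) ⟨0, by simp⟩
  refine ⟨i, by simpa [Nat.lt_succ_iff] using hi, ?_⟩
  have hmax' : ∀ j ≤ k, o (f j) ≤ max (o (f i)) (o (g i)) ∧ o (g j) ≤ max (o (f i)) (o (g i)) :=
    fun j hj => by simpa only [max_le_iff] using hmax j (by simpa [Nat.lt_succ_iff] using hj)
  rcases le_total (o (f i)) (o (g i)) with hle | hle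
  · rw [max_eq_right hle] at hmax'
    exact .inr fun j hj => (hmax' j hj).symm
  · rw [max_eq_left hle] at hmax'
    exact .inl hmax'

namespace IsTwinOrder

variable {o lev : V → ℕ}

theorem interior_not_max (h : IsTwinOrder G o) (hlev : ∀ x y, G.Adj x y → lev y ≤ lev x + 1)
    {f : ℕ → V} {k i : ℕ} (hf : IsAscending G lev f k) (hk : 3 ≤ k) (hi : 0 < i) (hik : i < k)
    (hmax : ∀ j ≤ k, o (f j) ≤ o (f i)) : False := by
  by_cases h2 : 2 ≤ i
  · obtain ⟨i, rfl⟩ := Nat.exists_eq_add_of_le' h2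
    have := hlev _ _ (h (f (i + 2)) (f (i + 1)) (f (i + 3)) (f i) (hmax _ (by omega))
      (hmax _ (by omega)) (hmax _ (by omega)) (hf.adj (i + 1) (by omega)).symm
      (hf.adj (i + 2) (by omega)) (hf.adj i (by omega)).symm).symm
    rw [hf.lev (i + 3) (by omega), hf.lev i (by omega)] at this
    omega
  · obtain rfl : i = 1 := by omega
    have := hlev _ _ (h (f 1) (f 2) (f 0) (f 3) (hmax _ (by omega)) (hmax _ (by omega))
      (hmax _ (by omega)) (hf.adj 1 (by omega)) (hf.adj 0 (by omega)).symm (hf.adj 2 (by omega)))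
    rw [hf.lev 3 (by omega)] at this
    omega

/-- The last but one vertices of two ascending paths with common ends have the same neighbours
among the vertices before them. -/
theorem adj_of_ascending (h : IsTwinOrder G o) (hlev : ∀ x y, G.Adj x y → lev y ≤ lev x + 1)
    (k : ℕ) : ∀ f g : ℕ → V, IsAscending G lev f (k + 2) → IsAscending G lev g (k + 2) →
      f 0 = g 0 → f (k + 2) = g (k + 2) →
      G.Adj (f k) (g (k + 1)) ∧ G.Adj (g k) (f (k + 1)) := by
  induction k with
  | zero =>
    intro f g hf hg h0 _
    exact ⟨h0 ▸ hg.adj 0 (by omega), h0 ▸ hf.adj 0 (by omega)⟩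
  | succ k ih =>
    have key : ∀ f g : ℕ → V, IsAscending G lev f (k + 3) → IsAscending G lev g (k + 3) →
        f 0 = g 0 → f (k + 3) = g (k + 3) → ∀ i ≤ k + 3,
        (∀ j ≤ k + 3, o (f j) ≤ o (f i) ∧ o (g j) ≤ o (f i)) →
        G.Adj (f (k + 1)) (g (k + 2)) ∧ G.Adj (g (k + 1)) (f (k + 2)) := by
      intro f g hf hg h0 ht i hi hmax
      have mf := fun j hj => (hmax j hj).1
      have mg := fun j hj => (hmax j hj).2
      have af := hf.adj 0 (by omega)
      have ag := hg.adj 0 (by omega)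
      rcases Nat.eq_zero_or_pos i with rfl | hpos
      · have hfg : G.Adj (f 1) (g 2) := h (f 0) (g 1) (f 1) (g 2) (mg _ (by omega))
          (mf _ (by omega)) (mg _ (by omega)) (h0 ▸ ag) af (hg.adj 1 (by omega))
        have hgf : G.Adj (g 1) (f 2) := h (f 0) (f 1) (g 1) (f 2) (mf _ (by omega))
          (mg _ (by omega)) (mf _ (by omega)) af (h0 ▸ ag) (hf.adj 1 (by omega))
        have := ih _ _ hf.tail
          (hg.tail_update (x := f 1) (by rw [← h0]; exact hf.lev 1 (by omega)) hfg) (by simp)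
          (by simpa using ht)
        refine ⟨by simpa using this.1, ?_⟩
        rcases k with _ | k
        · exact hgf
        · simpa using this.2
      rcases Nat.lt_or_ge i (k + 3) with hlt | hge
      · exact (h.interior_not_max hlev hf (by omega) hpos hlt mf).elim
      · obtain rfl : i = k + 3 := by omega
        have a1 := (hf.adj (k + 2) (by omega)).symm
        have a2 := (hg.adj (k + 2) (by omega)).symm
        have a2' : G.Adj (f (k + 3)) (g (k + 2)) := by rw [ht]; exact a2
        exact ⟨(h _ _ _ _ (mf _ (by omega)) (mg _ (by omega)) (mf _ (by omega)) a1 a2'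
          (hf.adj (k + 1) (by omega)).symm).symm, (h _ _ _ _ (mg _ (by omega)) (mf _ (by omega))
          (mg _ (by omega)) a2' a1 (hg.adj (k + 1) (by omega)).symm).symm⟩
    intro f g hf hg h0 ht
    obtain ⟨i, hi, hmax | hmax⟩ := exists_max_index o f g (k + 3)
    · exact key f g hf hg h0 ht i hi hmax
    · exact (key g f hg hf h0.symm ht.symm i hi hmax).symm

theorem not_adj_of_ascending (h : IsTwinOrder G o) (hlev : ∀ x y, G.Adj x y → lev y ≤ lev x + 1)
    (k : ℕ) : ∀ f g : ℕ → V, IsAscending G lev f k → IsAscending G lev g k →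
      f 0 = g 0 → ¬ G.Adj (f k) (g k) := by
  induction k with
  | zero =>
    intro f g _ _ h0
    rw [h0]
    exact G.irrefl
  | succ k ih =>
    have key : ∀ f g : ℕ → V, IsAscending G lev f (k + 1) → IsAscending G lev g (k + 1) →
        f 0 = g 0 → ∀ i ≤ k + 1, (∀ j ≤ k + 1, o (f j) ≤ o (f i) ∧ o (g j) ≤ o (f i)) →
        ¬ G.Adj (f (k + 1)) (g (k + 1)) := by
      intro f g hf hg h0 i hi hmax hadj
      have mf := fun j hj => (hmax j hj).1
      have mg := fun j hj => (hmax j hj).2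
      have af := hf.adj 0 (by omega)
      have ag := hg.adj 0 (by omega)
      rcases k with _ | k
      · rcases Nat.eq_zero_or_pos i with rfl | hpos
        · exact G.irrefl (h (f 0) (f 1) (g 1) (g 1) (mf _ (by omega)) (mg _ (by omega))
            (mg _ (by omega)) af (h0 ▸ ag) hadj)
        · obtain rfl : i = 1 := by omega
          exact G.irrefl (h (f 1) (f 0) (g 1) (g 1) (mf _ (by omega)) (mg _ (by omega))
            (mg _ (by omega)) af.symm hadj (h0 ▸ ag))
      rcases Nat.eq_zero_or_pos i with rfl | hpos
      · have hfg : G.Adj (f 1) (g 2) := h (f 0) (g 1) (f 1) (g 2) (mg _ (by omega))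
          (mf _ (by omega)) (mg _ (by omega)) (h0 ▸ ag) af (hg.adj 1 (by omega))
        exact ih _ _ hf.tail
          (hg.tail_update (x := f 1) (by rw [← h0]; exact hf.lev 1 (by omega)) hfg) (by simp)
          (by simpa using hadj)
      rcases Nat.lt_or_ge i (k + 2) with hlt | hge
      · rcases k with _ | k
        · obtain rfl : i = 1 := by omega
          have := hlev _ _ (h (f 1) (f 2) (f 0) (g 2) (mf _ (by omega)) (mf _ (by omega))
            (mg _ (by omega)) (hf.adj 1 (by omega)) af.symm hadj)
          rw [hg.lev 2 (by omega), h0] at this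
          omega
        · exact h.interior_not_max hlev hf (by omega) hpos hlt mf
      · obtain rfl : i = k + 2 := by omega
        have := hlev _ _ (h (f (k + 2)) (f (k + 1)) (g (k + 2)) (f k) (mf _ (by omega))
          (mg _ (by omega)) (mf _ (by omega)) (hf.adj (k + 1) (by omega)).symm hadj
          (hf.adj k (by omega)).symm).symm
        rw [hg.lev (k + 2) (by omega), hf.lev k (by omega), h0] at this
        omega
    intro f g hf hg h0
    obtain ⟨i, hi, hmax | hmax⟩ := exists_max_index o f g (k + 1)
    · exact key f g hf hg h0 i hi hmax
    · exact fun hadj => key g f hg hf h0.symm i hi hmax hadj.symm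

/-- There is no induced domino: a closed walk with six steps has two crossing chords. -/
theorem hexagon (h : IsTwinOrder G o) {v y p z w b : V} (hvy : G.Adj v y) (hyp : G.Adj y p)
    (hpz : G.Adj p z) (hzw : G.Adj z w) (hwb : G.Adj w b) (hbv : G.Adj b v) :
    G.Adj v z ∨ G.Adj w y := by
  classical
  obtain ⟨a, ha, hmax⟩ := Finset.exists_max_image {v, y, p, z, w, b} o ⟨v, by simp⟩
  simp only [Finset.mem_insert, Finset.mem_singleton, forall_eq_or_imp, forall_eq] at ha hmax
  obtain ⟨mv, my, mp, mz, mw, mb⟩ := hmax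
  rcases ha with rfl | rfl | rfl | rfl | rfl | rfl
  · exact .inr (h a b y w mb my mw hbv.symm hvy hwb.symm).symm
  · exact .inl (h a p v z mp mv mz hyp hvy.symm hpz)
  · exact .inl (h a y z v my mz mv hyp.symm hpz hvy.symm).symm
  · exact .inr (h a p w y mp mw my hpz.symm hzw hyp.symm)
  · exact .inl (h a b z v mb mz mv hwb hzw.symm hbv).symm
  · exact .inr (h a v w y mv mw my hbv hwb.symm hvy)

end IsTwinOrder

end GraphTheory

/-! ## Breadth first search trees -/

section BreadthFirst

variable {V : Type*} {G : SimpleGraph V} {n : ℕ}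

/-- A numbering together with levels and parents as computed by breadth first search. The
roots are the vertices on level `0`. -/
structure IsBFSTree (G : SimpleGraph V) (φ : V ≃ Fin n) (lev : V → ℕ) (par : V → V) : Prop where
  root : ∀ v, lev v = 0 → ∀ x y, G.Adj x y → φ x < φ v → φ y < φ v
  adj_par : ∀ v, lev v ≠ 0 → G.Adj (par v) v
  par_lt : ∀ v, lev v ≠ 0 → φ (par v) < φ v
  lev_par : ∀ v, lev v ≠ 0 → lev v = lev (par v) + 1
  par_le : ∀ v x, lev v ≠ 0 → G.Adj x v → φ (par v) ≤ φ x
  par_mono : ∀ v w, lev v ≠ 0 → lev w ≠ 0 → φ v ≤ φ w → φ (par v) ≤ φ (par w)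

namespace IsBFSTree

variable {φ : V ≃ Fin n} {lev : V → ℕ} {par : V → V}

theorem isBFSNumbering (h : IsBFSTree G φ lev par) : IsBFSNumbering G φ := by
  intro a b c hab hbc hac hmin
  have hb : lev b ≠ 0 := fun e => absurd (h.root b e a c hac hab) (not_lt.2 hbc)
  have hc : lev c ≠ 0 := fun e => absurd (h.root c e a c hac (hab.trans_le hbc)) (lt_irrefl _)
  have h1 : φ a ≤ φ (par b) := not_lt.1 fun hlt => hmin _ _ hlt le_rfl (h.adj_par b hb)
  have h2 := (h.par_mono b c hb hc hbc).trans (h.par_le c a hc hac)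
  rw [φ.injective (h1.antisymm h2)]
  exact h.adj_par b hb

theorem induction (h : IsBFSTree G φ lev par) {P : V → Prop} (h0 : ∀ v, lev v = 0 → P v)
    (hs : ∀ v, lev v ≠ 0 → P (par v) → P v) (v : V) : P v := by
  induction hk : (φ v : ℕ) using Nat.strong_induction_on generalizing v with
  | _ k ih =>
    by_cases hv : lev v = 0
    · exact h0 v hv
    · exact hs v hv (ih _ (hk ▸ h.par_lt v hv) _ rfl)

theorem lt_of_reachable (h : IsBFSTree G φ lev par) {r x y : V} (hr : lev r = 0)
    (hxy : G.Reachable x y) (hx : φ x < φ r) : φ y < φ r := by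
  obtain ⟨p⟩ := hxy
  induction p with
  | nil => exact hx
  | cons hadj _ ih => exact ih (h.root r hr _ _ hadj hx)

theorem root_unique (h : IsBFSTree G φ lev par) {r s : V} (hr : lev r = 0) (hs : lev s = 0)
    (hrs : G.Reachable r s) : r = s := by
  by_contra hne
  rcases lt_or_gt_of_ne (fun e => hne (φ.injective e)) with hlt | hlt
  · exact lt_irrefl _ (h.lt_of_reachable hs hrs hlt)
  · exact lt_irrefl _ (h.lt_of_reachable hr hrs.symm hlt)

theorem lev_ne_zero_of_reachable (h : IsBFSTree G φ lev par) {x y r : V} (hxy : G.Reachable x y)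
    (hx : φ x < φ r) (hy : φ r ≤ φ y) : lev r ≠ 0 :=
  fun hr => absurd (h.lt_of_reachable hr hxy hx) (not_lt.2 hy)

theorem lev_mono (h : IsBFSTree G φ lev par) {a b : V} (hab : φ a ≤ φ b)
    (hr : ∀ r, φ a < φ r → φ r ≤ φ b → lev r ≠ 0) : lev a ≤ lev b := by
  induction hk : (φ b : ℕ) using Nat.strong_induction_on generalizing a b with
  | _ k ih =>
    rcases hab.eq_or_lt with he | hlt
    · rw [φ.injective he]
    have hb := hr b hlt le_rfl
    by_cases ha : lev a = 0
    · omega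
    rw [h.lev_par a ha, h.lev_par b hb]
    refine Nat.succ_le_succ (ih _ (hk ▸ h.par_lt b hb) (h.par_mono a b ha hb hab) ?_ rfl)
    intro r h1 h2
    by_cases hra : φ r ≤ φ a
    · exact h.lev_ne_zero_of_reachable (h.adj_par a ha).reachable h1 hra
    · exact hr r (not_le.1 hra) (h2.trans (h.par_lt b hb).le)

theorem lev_le_of_reachable (h : IsBFSTree G φ lev par) {a b : V} (hab : φ a ≤ φ b)
    (hr : G.Reachable a b) : lev a ≤ lev b :=
  h.lev_mono hab fun _ => h.lev_ne_zero_of_reachable hr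

theorem lev_le_succ (h : IsBFSTree G φ lev par) (x y : V) (hxy : G.Adj x y) :
    lev y ≤ lev x + 1 := by
  rcases le_total (φ y) (φ x) with hle | hle
  · exact (h.lev_le_of_reachable hle hxy.symm.reachable).trans (Nat.le_succ _)
  · by_cases hy : lev y = 0
    · omega
    · rw [h.lev_par y hy]
      exact Nat.succ_le_succ (h.lev_le_of_reachable (h.par_le y x hy hxy)
        ((h.adj_par y hy).reachable.trans hxy.symm.reachable))

theorem lt_of_lev_lt (h : IsBFSTree G φ lev par) {x y : V} (hxy : G.Reachable x y)
    (hl : lev x < lev y) : φ x < φ y :=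
  not_le.1 fun hle => absurd (h.lev_le_of_reachable hle hxy.symm) (not_le.2 hl)

theorem lev_le_length (h : IsBFSTree G φ lev par) {x y : V} (p : G.Walk x y) :
    lev y ≤ lev x + p.length := by
  induction p with
  | nil => simp
  | cons hadj _ ih =>
    have := h.lev_le_succ _ _ hadj
    rw [SimpleGraph.Walk.length_cons]
    omega

theorem exists_root (h : IsBFSTree G φ lev par) (v : V) :
    ∃ r, lev r = 0 ∧ φ r ≤ φ v ∧ G.Reachable r v ∧ G.dist r v ≤ lev v ∧
      ∃ f, IsAscending G lev f (lev v) ∧ f 0 = r ∧ f (lev v) = v := by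
  refine h.induction (P := fun v => ∃ r, lev r = 0 ∧ φ r ≤ φ v ∧ G.Reachable r v ∧
    G.dist r v ≤ lev v ∧ ∃ f, IsAscending G lev f (lev v) ∧ f 0 = r ∧ f (lev v) = v) ?_ ?_ v
  · exact fun v hv => ⟨v, hv, le_rfl, .refl _, by simp, fun _ => v,
      ⟨fun i hi => by omega, fun i hi => by omega⟩, rfl, rfl⟩
  · rintro v hv ⟨r, hr, hle, hreach, hdist, f, hf, hf0, hft⟩
    have hadj := h.adj_par v hv
    have hl := h.lev_par v hv
    refine ⟨r, hr, hle.trans (h.par_lt v hv).le, hreach.trans hadj.reachable, ?_,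
      fun i => if i ≤ lev (par v) then f i else v, ?_, ?_, ?_⟩
    · obtain ⟨p, hp⟩ := hreach.exists_walk_length_eq_dist
      have := SimpleGraph.dist_le (p.concat hadj)
      rw [SimpleGraph.Walk.length_concat] at this
      omega
    · rw [hl]
      exact hf.extend (hft.symm ▸ hadj) (by rw [hf0, hr, hl]; omega)
    · simp [hf0]
    · simp [hl]

theorem lev_eq_zero_of_isStartVertex (h : IsBFSTree G φ lev par) {u : V}
    (hu : IsStartVertex G φ u) : lev u = 0 := by
  by_contra hne
  exact absurd (h.par_lt u hne) (not_lt.2 (hu _ (h.adj_par u hne).symm.reachable))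

theorem dist_eq (h : IsBFSTree G φ lev par) {u v : V} (hu : lev u = 0)
    (huv : G.Reachable u v) : G.dist u v = lev v := by
  obtain ⟨r, hr, -, hreach, hdist, -⟩ := h.exists_root v
  obtain rfl : r = u := h.root_unique hr hu (hreach.trans huv.symm)
  obtain ⟨p, hp⟩ := huv.exists_walk_length_eq_dist
  have := h.lev_le_length p
  omega

theorem mem_levelSet_iff (h : IsBFSTree G φ lev par) {u v : V} {k : ℕ} (hu : IsStartVertex G φ u) :
    v ∈ levelSet G u k ↔ G.Reachable u v ∧ lev v = k :=
  and_congr_right fun hr => by rw [h.dist_eq (h.lev_eq_zero_of_isStartVertex hu) hr]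

theorem reachable_of_no_root (h : IsBFSTree G φ lev par) {a b : V} (hab : φ a ≤ φ b)
    (hr : ∀ r, φ a < φ r → φ r ≤ φ b → lev r ≠ 0) : G.Reachable a b := by
  obtain ⟨r, hr0, hra, hrr, -⟩ := h.exists_root a
  obtain ⟨s, hs0, hsb, hss, -⟩ := h.exists_root b
  have hsa : φ s ≤ φ a := not_lt.1 fun hlt => hr s hlt hsb hs0
  have h1 : φ r ≤ φ s := not_lt.1 fun hlt =>
    h.lev_ne_zero_of_reachable hss hlt (hra.trans hab) hr0
  have h2 : φ s ≤ φ r := not_lt.1 fun hlt => h.lev_ne_zero_of_reachable hrr hlt hsa hs0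
  obtain rfl := φ.injective (h1.antisymm h2)
  exact hrr.symm.trans hss

/-! ### The levels of bipartite distance hereditary graphs -/

variable {o : V → ℕ}

theorem lev_ne_of_adj (h : IsBFSTree G φ lev par) (ho : IsTwinOrder G o) {x y : V}
    (hxy : G.Adj x y) : lev x ≠ lev y := by
  intro hl
  obtain ⟨r, hr, -, hrx, -, f, hf, hf0, hft⟩ := h.exists_root x
  obtain ⟨s, hs, -, hsy, -, g, hg, hg0, hgt⟩ := h.exists_root y
  have := h.root_unique hr hs ((hrx.trans hxy.reachable).trans hsy.symm)
  rw [← hl] at hg hgt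
  refine ho.not_adj_of_ascending h.lev_le_succ (lev x) f g hf hg (by rw [hf0, hg0, this]) ?_
  rwa [hft, hgt]

theorem lev_of_adj (h : IsBFSTree G φ lev par) (ho : IsTwinOrder G o) {x y : V}
    (hxy : G.Adj x y) : lev x = lev y + 1 ∨ lev y = lev x + 1 := by
  have h1 := h.lev_le_succ _ _ hxy
  have h2 := h.lev_le_succ _ _ hxy.symm
  have := h.lev_ne_of_adj ho hxy
  omega

/-- The neighbours of a vertex on the previous level have the same neighbours one level further
up. -/
theorem adj_of_common_child (h : IsBFSTree G φ lev par) (ho : IsTwinOrder G o) {x y z p : V}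
    (hxy : G.Adj x y) (hxz : G.Adj x z) (hyp : G.Adj y p) (hy : lev y + 1 = lev x)
    (hz : lev z + 1 = lev x) (hp : lev p + 1 = lev y) : G.Adj z p := by
  obtain ⟨r, hr, -, hrp, -, f, hf, hf0, hft⟩ := h.exists_root p
  obtain ⟨s, hs, -, hsz, -, g, hg, hg0, hgt⟩ := h.exists_root z
  have hrs : r = s := h.root_unique hr hs
    ((((hrp.trans hyp.symm.reachable).trans hxy.symm.reachable).trans hxz.reachable).trans
      hsz.symm)
  have hzp : lev z = lev p + 1 := by omega
  rw [hzp] at hg hgt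
  have hf1 := hf.extend (x := y) (hft.symm ▸ hyp.symm) (by rw [hf0, hr]; omega)
  have hf2 := hf1.extend (x := x) (by simpa using hxy.symm) (by simp only [zero_le, if_true, hf0, hr]; omega)
  have hg2 := hg.extend (x := x) (hgt.symm ▸ hxz.symm) (by rw [hg0, hs]; omega)
  have := (ho.adj_of_ascending h.lev_le_succ (lev p) _ _ hf2 hg2 (by simp [hf0, hg0, hrs])
    (by simp)).1
  simp only [le_add_iff_nonneg_right, zero_le, le_refl, if_true, hft, hgt] at this
  exact this.symm

/-- Neighbourhoods in the previous level are disjoint or nested. -/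
theorem nested (h : IsBFSTree G φ lev par) (ho : IsTwinOrder G o) {v w b y z : V}
    (hvb : G.Adj v b) (hwb : G.Adj w b) (hvy : G.Adj v y) (hwz : G.Adj w z)
    (hvw : lev v = lev w) (hb : lev b + 1 = lev v) (hy : lev y + 1 = lev v)
    (hz : lev z + 1 = lev w) : G.Adj v z ∨ G.Adj w y := by
  by_cases h0 : lev b = 0
  · have := h.root_unique h0 (by omega : lev y = 0) (hvb.symm.reachable.trans hvy.reachable)
    exact .inr (this ▸ hwb)
  · have hp := h.adj_par b h0
    have hl := h.lev_par b h0
    have hyp := h.adj_of_common_child ho hvb hvy hp.symm hb hy hl.symm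
    have hzp := h.adj_of_common_child ho hwb hwz hp.symm (by omega) hz hl.symm
    exact ho.hexagon hvy hyp hzp.symm hwz.symm hwb hvb.symm

/-- Sorting the levels by inclusion yields an independent module-sequence. -/
theorem isIndependentModuleSequence_of_sorted (h : IsBFSTree G φ lev par) (ho : IsTwinOrder G o)
    {ψ : V ≃ Fin n} (hψ : ∀ x y, G.Adj x y → lev x < lev y → ψ x < ψ y)
    (hs : ∀ v w, G.Reachable v w → lev v = lev w →
      {x | G.Adj w x ∧ lev x + 1 = lev w} ⊂ {x | G.Adj v x ∧ lev x + 1 = lev v} → ψ v < ψ w) :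
    IsIndependentModuleSequence G ψ := by
  rw [isIndependentModuleSequence_iff]
  intro a b c d hb hc hd hab hac hbd
  have back : ∀ x, G.Adj a x → ψ x < ψ a → lev x + 1 = lev a := fun x hax hx => by
    rcases h.lev_of_adj ho hax with e | e
    · exact e.symm
    · exact absurd (hψ a x hax (by omega)) (not_lt.2 hx.le)
  have lb := back b hab hb
  have lc := back c hac hc
  rcases h.lev_of_adj ho hbd with e | e
  · exact h.adj_of_common_child ho hab hac hbd lb lc e.symm
  · by_contra hcd
    refine absurd (hs a d (hab.reachable.trans hbd.reachable) (by omega) ⟨?_, ?_⟩)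
      (not_lt.2 hd.le)
    · rintro z ⟨hdz, hz⟩
      refine ⟨?_, by omega⟩
      exact (h.nested ho hbd.symm hab hdz hac (by omega) e.symm hz lc).resolve_left
        fun hdc => hcd hdc.symm
    · exact fun hsub => hcd (hsub ⟨hac, lc⟩).1.symm

end IsBFSTree

/-! ### Blocks of consecutive vertices of the same level -/

/-- `cls v` is the first position of the maximal run of vertices that lie, like `v`, on the same
level of the same search tree. -/
structure IsBlockStart (φ : V ≃ Fin n) (lev cls : V → ℕ) : Prop where
  eq_of_succ : ∀ p v, (φ v : ℕ) = φ p + 1 → lev v ≠ 0 → lev p = lev v → cls v = cls p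
  eq_self : ∀ v, (lev v = 0 ∨ ∃ p, (φ v : ℕ) = φ p + 1 ∧ lev p ≠ lev v) → cls v = φ v

namespace IsBlockStart

variable {φ : V ≃ Fin n} {lev cls : V → ℕ} {par : V → V}

theorem exists_pred (φ : V ≃ Fin n) {v : V} (hv : 0 < (φ v : ℕ)) : ∃ p, (φ v : ℕ) = φ p + 1 :=
  ⟨φ.symm ⟨φ v - 1, by omega⟩, by simp; omega⟩

theorem interval (hc : IsBlockStart φ lev cls) (h : IsBFSTree G φ lev par) (v : V) :
    cls v ≤ φ v ∧ ∀ x, cls v ≤ φ x → φ x ≤ φ v →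
      cls x = cls v ∧ lev x = lev v ∧ (cls v < φ x → lev x ≠ 0) := by
  induction hk : (φ v : ℕ) using Nat.strong_induction_on generalizing v with
  | _ k ih =>
    by_cases hcv : cls v = φ v
    · refine ⟨by omega, fun x hx hxv => ?_⟩
      obtain rfl := φ.injective (le_antisymm hxv (show (φ v : ℕ) ≤ φ x by omega))
      exact ⟨rfl, rfl, fun hlt => by omega⟩
    have hv : lev v ≠ 0 := fun e => hcv (hc.eq_self v (.inl e))
    have hpos : 0 < (φ v : ℕ) := lt_of_le_of_lt (Nat.zero_le _) (h.par_lt v hv)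
    obtain ⟨p, hp⟩ := exists_pred φ hpos
    have hl : lev p = lev v := by
      by_contra hne
      exact hcv (hc.eq_self v (.inr ⟨p, hp, hne⟩))
    have hcp := hc.eq_of_succ p v hp hv hl
    obtain ⟨h1, h2⟩ := ih (φ p) (by omega) p rfl
    refine ⟨by omega, fun x hx hxv => ?_⟩
    by_cases hxe : x = v
    · subst hxe
      exact ⟨rfl, rfl, fun _ => hv⟩
    · have : (φ x : ℕ) ≠ φ v := fun e => hxe (φ.injective (Fin.ext e))
      have hxv' : (φ x : ℕ) ≤ φ v := hxv
      obtain ⟨e1, e2, e3⟩ := h2 x (by omega) (by show (φ x : ℕ) ≤ φ p; omega)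
      exact ⟨by omega, by omega, by rwa [hcp]⟩

theorem mono (hc : IsBlockStart φ lev cls) (h : IsBFSTree G φ lev par) {a b : V}
    (hab : φ a ≤ φ b) : cls a ≤ cls b := by
  by_cases hle : cls b ≤ φ a
  · exact ((hc.interval h b).2 a hle hab).1.le
  · exact (hc.interval h a).1.trans (not_le.1 hle).le

theorem same_level (hc : IsBlockStart φ lev cls) (h : IsBFSTree G φ lev par) {a b : V}
    (hab : cls a = cls b) : lev a = lev b ∧ G.Reachable a b := by
  wlog hle : φ a ≤ φ b generalizing a b
  · have := this hab.symm (not_le.1 hle).le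
    exact ⟨this.1.symm, this.2.symm⟩
  have ha := (hc.interval h a).1
  have hb := (hc.interval h b).2
  refine ⟨(hb a (by omega) hle).2.1, h.reachable_of_no_root hle fun r h1 h2 => ?_⟩
  have h1' : (φ a : ℕ) < φ r := h1
  exact (hb r (by omega) h2).2.2 (by omega)

theorem eq_of_same_level (hc : IsBlockStart φ lev cls) (h : IsBFSTree G φ lev par) {a b : V}
    (hl : lev a = lev b) (hr : G.Reachable a b) : cls a = cls b := by
  wlog hle : φ a ≤ φ b generalizing a b
  · exact (this hl.symm hr.symm (not_le.1 hle).le).symm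
  have key : ∀ k : ℕ, ∀ x, (φ x : ℕ) = φ a + k → φ x ≤ φ b → cls x = cls a := by
    intro k
    induction k with
    | zero =>
      intro x hx _
      rw [φ.injective (Fin.ext hx : φ x = φ a)]
    | succ k ih =>
      intro x hx hxb
      obtain ⟨p, hp⟩ := exists_pred φ (v := x) (by omega)
      have no : ∀ r, φ a < φ r → φ r ≤ φ b → lev r ≠ 0 :=
        fun r => h.lev_ne_zero_of_reachable hr
      have btw : ∀ y, φ a ≤ φ y → φ y ≤ φ b → lev y = lev a := fun y h1 h2 =>
        le_antisymm (hl ▸ h.lev_mono h2 fun r hr1 hr2 => no r (h1.trans_lt hr1) hr2)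
          (h.lev_mono h1 fun r hr1 hr2 => no r hr1 (hr2.trans h2))
      have hax : φ a < φ x := by show (φ a : ℕ) < φ x; omega
      have hap : φ a ≤ φ p := by show (φ a : ℕ) ≤ φ p; omega
      have hpx : φ p ≤ φ x := by show (φ p : ℕ) ≤ φ x; omega
      rw [hc.eq_of_succ p x hp (no x hax hxb)
        ((btw p hap (hpx.trans hxb)).trans (btw x hax.le hxb).symm)]
      exact ih p (by omega) (hpx.trans hxb)
  exact (key (φ b - φ a) b (by have : (φ a : ℕ) ≤ φ b := hle; omega) le_rfl).symm

variable {ψ : V ≃ Fin n}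

theorem isLevelRearrangement (hc : IsBlockStart φ lev cls) (h : IsBFSTree G φ lev par)
    (hψ : ∀ p, cls (ψ.symm p) = cls (φ.symm p)) : IsLevelRearrangement G φ ψ := by
  intro u hu k
  have key : ∀ p, ψ.symm p ∈ levelSet G u k ↔ φ.symm p ∈ levelSet G u k := fun p => by
    obtain ⟨hl, hr⟩ := hc.same_level h (hψ p)
    rw [h.mem_levelSet_iff hu, h.mem_levelSet_iff hu, hl]
    exact and_congr_left fun _ => ⟨fun h' => h'.trans hr, fun h' => h'.trans hr.symm⟩
  ext p
  simp only [Equiv.image_eq_preimage_symm, Set.mem_preimage, key]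

theorem lt_of_lev_lt (hc : IsBlockStart φ lev cls) (h : IsBFSTree G φ lev par)
    (hψ : ∀ p, cls (ψ.symm p) = cls (φ.symm p)) {x y : V} (hxy : G.Adj x y)
    (hl : lev x < lev y) : ψ x < ψ y := by
  by_contra hle
  have h1 := hc.mono h (a := φ.symm (ψ y)) (b := φ.symm (ψ x)) (by simpa using hle)
  rw [← hψ, ← hψ, Equiv.symm_apply_apply, Equiv.symm_apply_apply] at h1
  have h2 := hc.mono h (h.lt_of_lev_lt hxy.reachable hl).le
  have := (hc.same_level h (h2.antisymm h1)).1
  omega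

theorem isSortedByInclusion (h : IsBFSTree G φ lev par)
    (hs : ∀ v w, G.Reachable v w → lev v = lev w →
      {x | G.Adj w x ∧ lev x + 1 = lev w} ⊂ {x | G.Adj v x ∧ lev x + 1 = lev v} → ψ v < ψ w) :
    IsSortedByInclusion G φ ψ := by
  intro u hu k v hv w hw hsub
  have key : ∀ v, G.Reachable u v ∧ lev v = k + 1 →
      G.neighborSet v ∩ levelSet G u k = {x | G.Adj v x ∧ lev x + 1 = lev v} := by
    rintro v ⟨hr, hl⟩
    ext x
    simp only [Set.mem_inter_iff, h.mem_levelSet_iff hu, SimpleGraph.mem_neighborSet,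
      Set.mem_ofPred_eq]
    constructor
    · rintro ⟨h1, h2, h3⟩
      exact ⟨h1, by omega⟩
    · rintro ⟨h1, h2⟩
      exact ⟨h1, hr.trans h1.reachable, by omega⟩
  rw [h.mem_levelSet_iff hu] at hv hw
  rw [key v hv, key w hw] at hsub
  exact hs v w (hv.1.symm.trans hw.1) (by omega) hsub

end IsBlockStart

end BreadthFirst

/-! ## A local test for twin orders -/

section TwinTest

/-- One more than the last number below `i` with the property `A`, or `0` if there is none. -/
def lastBefore (A : ℕ → Prop) [DecidablePred A] : ℕ → ℕ
  | 0 => 0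
  | i + 1 => if A i then i + 1 else lastBefore A i

section

variable {A B : ℕ → Prop} [DecidablePred A] [DecidablePred B]

theorem lt_lastBefore {i j : ℕ} (hj : A j) (hji : j < i) : j < lastBefore A i := by
  induction i with
  | zero => omega
  | succ i ih =>
    rw [lastBefore]
    split_ifs with h
    · exact hji
    · exact ih (lt_of_le_of_ne (Nat.le_of_lt_succ hji) fun e => h (e ▸ hj))

theorem lastBefore_spec {i l : ℕ} (h : lastBefore A i = l + 1) : l < i ∧ A l := by
  induction i with
  | zero => simp [lastBefore] at h
  | succ i ih =>
    rw [lastBefore] at h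
    split_ifs at h with hA
    · obtain rfl : i = l := by omega
      exact ⟨by omega, hA⟩
    · exact ⟨by have := (ih h).1; omega, (ih h).2⟩

theorem lastBefore_congr {i : ℕ} (h : ∀ l < i, A l ↔ B l) : lastBefore A i = lastBefore B i := by
  induction i with
  | zero => rfl
  | succ i ih =>
    rw [lastBefore, lastBefore, ih fun l hl => h l (by omega)]
    simp only [h i (by omega)]

theorem count_congr_of_lt {i : ℕ} (h : ∀ l < i, A l ↔ B l) : Nat.count A i = Nat.count B i := by
  rw [Nat.count_eq_card_filter_range, Nat.count_eq_card_filter_range]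
  exact congrArg _ (Finset.filter_congr fun l hl => h l (Finset.mem_range.1 hl))

theorem iff_of_count_eq {i : ℕ} (h : ∀ l < i, A l → B l) (hc : Nat.count A i = Nat.count B i) :
    ∀ l < i, A l ↔ B l := by
  intro l hl
  refine ⟨h l hl, fun hB => ?_⟩
  rw [Nat.count_eq_card_filter_range, Nat.count_eq_card_filter_range] at hc
  have := Finset.eq_of_subset_of_card_le (s := (Finset.range i).filter A)
    (t := (Finset.range i).filter B) (fun l hl => by
      simp only [Finset.mem_filter, Finset.mem_range] at hl ⊢
      exact ⟨hl.1, h l hl.1 hl.2⟩) hc.ge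
  have hl' : l ∈ (Finset.range i).filter B := by simp [hl, hB]
  rw [← this] at hl'
  exact (Finset.mem_filter.1 hl').2

end

variable {A : ℕ → ℕ → Prop} [∀ i, DecidablePred (A i)]

theorem iff_of_lastBefore_eq (symm : ∀ i j, A i j → A j i) (irrefl : ∀ i, ¬ A i i)
    (h : ∀ i j k, j < i → k < i → A i j → A i k →
      lastBefore (A j) i = lastBefore (A k) i ∧ Nat.count (A j) i = Nat.count (A k) i)
    (i j k : ℕ) (hj : j < i) (hk : k < i) (hij : A i j) (hik : A i k) :
    ∀ l < i, A j l ↔ A k l := by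
  induction i using Nat.strong_induction_on generalizing j k with
  | _ i ih =>
    wlog hjk : j < k generalizing j k
    · rcases (not_lt.1 hjk).eq_or_lt with rfl | hlt
      · exact fun l _ => Iff.rfl
      · exact fun l hl => (this k j hk hj hik hij hlt l hl).symm
    obtain ⟨hlast, hcount⟩ := h i j k hj hk hij hik
    rcases hd : lastBefore (A k) i with _ | d
    · rw [hd] at hlast
      intro l hl
      refine ⟨fun h' => ?_, fun h' => ?_⟩
      · have := lt_lastBefore h' hl; omega
      · have := lt_lastBefore h' hl; omega
    rw [hd] at hlast
    obtain ⟨hdi, hkd⟩ := lastBefore_spec hd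
    obtain ⟨-, hjd⟩ := lastBefore_spec hlast
    have hdk : d ≠ k := fun e => irrefl k (e ▸ hkd)
    rcases lt_or_gt_of_ne hdk with hlt | hlt
    · refine iff_of_count_eq (fun l hl hjl => ?_) hcount.symm |> fun h' l hl => (h' l hl).symm
      have hlk : l ≤ d := by have := lt_lastBefore hjl hl; omega
      exact symm _ _ ((ih k hk d l hlt (by omega) hkd hjl j hjk).1 (symm _ _ hjd))
    · intro l hl
      rcases lt_trichotomy l d with h' | rfl | h'
      · exact ih d hdi j k (by omega) (by omega) (symm _ _ hjd) (symm _ _ hkd) l h'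
      · exact iff_of_true hjd hkd
      · refine ⟨fun h'' => ?_, fun h'' => ?_⟩
        · have := lt_lastBefore h'' hl; omega
        · have := lt_lastBefore h'' hl; omega

/-- The neighbours of each vertex `i` among the vertices before it are compared with the last one
of them. -/
def PassesTest (A : ℕ → ℕ → Prop) [∀ i, DecidablePred (A i)] (i : ℕ) : Prop :=
  ∀ j < i, A i j → lastBefore (A j) i = lastBefore (A (lastBefore (A i) i - 1)) i ∧
    Nat.count (A j) i = Nat.count (A (lastBefore (A i) i - 1)) i

theorem passesTest_iff (symm : ∀ i j, A i j → A j i) (irrefl : ∀ i, ¬ A i i) :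
    (∀ i, PassesTest A i) ↔
      ∀ i j k l, j < i → k < i → l < i → A i j → A i k → A j l → A k l := by
  constructor
  · intro h i j k l hj hk hl hij hik hjl
    refine (iff_of_lastBefore_eq symm irrefl (fun i j k hj hk hij hik => ?_) i j k hj hk hij hik
      l hl).1 hjl
    have h1 := h i j hj hij
    have h2 := h i k hk hik
    exact ⟨h1.1.trans h2.1.symm, h1.2.trans h2.2.symm⟩
  · intro h i j hj hij
    have hpos := lt_lastBefore hij hj
    obtain ⟨d, hd⟩ : ∃ d, lastBefore (A i) i = d + 1 := ⟨_, (Nat.succ_pred_eq_of_pos (by omega)).symm⟩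
    obtain ⟨hdi, hid⟩ := lastBefore_spec hd
    rw [hd, Nat.add_sub_cancel]
    have key : ∀ l < i, A j l ↔ A d l := fun l hl =>
      ⟨h i j d l hj hdi hl hij hid, h i d j l hdi hj hl hid hij⟩
    exact ⟨lastBefore_congr key, count_congr_of_lt key⟩

end TwinTest

/-! ## The program: breadth first search -/

/-- The lists `N v`, `v < n`, are the adjacency lists of a graph on `{0, …, n - 1}`. -/
structure IsAdjacency (n : ℕ) (N : ℕ → List ℕ) : Prop where
  symm : ∀ v w, w ∈ N v → v ∈ N w
  irrefl : ∀ v, v ∉ N v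
  lt : ∀ v w, w ∈ N v → v < n
  nodup : ∀ v, (N v).Nodup

/-- The state of breadth first search: `Q` is the queue of length `t`, whose first `h` entries
have been processed, `pos v` is one more than the position of `v` in the queue, or `0` if `v`
has not been found, all vertices below `s` have been found, and all parents are among
the first `m` entries of the queue. -/
structure BFSState (n : ℕ) (N : ℕ → List ℕ) (Q lev pos par : ℕ → ℕ) (s h m t : ℕ) : Prop where
  le : h ≤ t
  s_le : s ≤ n
  pos_queue : ∀ i < t, Q i < n ∧ pos (Q i) = i + 1
  queue_pos : ∀ v < n, pos v ≠ 0 → pos v ≤ t ∧ Q (pos v - 1) = v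
  found : ∀ v < s, pos v ≠ 0
  processed : ∀ i < h, ∀ w ∈ N (Q i), pos w ≠ 0
  root : ∀ v < n, pos v ≠ 0 → lev v = 0 → ∀ x y, y ∈ N x → pos x ≠ 0 → pos x < pos v →
    pos y ≠ 0 ∧ pos y < pos v
  mem_par : ∀ v < n, pos v ≠ 0 → lev v ≠ 0 → v ∈ N (par v) ∧ lev v = lev (par v) + 1
  pos_par : ∀ v < n, pos v ≠ 0 → lev v ≠ 0 → pos (par v) ≠ 0 ∧ pos (par v) ≤ m ∧
    pos (par v) < pos v
  par_le : ∀ v < n, pos v ≠ 0 → lev v ≠ 0 → ∀ x, v ∈ N x → pos x ≠ 0 → pos (par v) ≤ pos x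
  par_mono : ∀ v < n, ∀ w < n, pos v ≠ 0 → pos w ≠ 0 → lev v ≠ 0 → lev w ≠ 0 →
    pos v ≤ pos w → pos (par v) ≤ pos (par w)

namespace BFSState

variable {n : ℕ} {N : ℕ → List ℕ} {Q lev pos par : ℕ → ℕ} {s h m t : ℕ}

open Function in
theorem push_child (hS : BFSState n N Q lev pos par s h (h + 1) t) (hN : IsAdjacency n N)
    (ht : h < t) {w : ℕ} (hw : w ∈ N (Q h)) (hpos : pos w = 0) :
    BFSState n N (update Q t w) (update lev w (lev (Q h) + 1)) (update pos w (t + 1))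
      (update par w (Q h)) s h (h + 1) (t + 1) := by
  have hwn : w < n := hN.lt _ _ (hN.symm _ _ hw)
  obtain ⟨hQn, hQp⟩ := hS.pos_queue h ht
  have hlate : ∀ x, w ∈ N x → pos x ≠ 0 → h + 1 ≤ pos x := by
    intro x hx hpx
    by_contra hlt
    have := (hS.queue_pos x (hN.lt _ _ hx) hpx).2
    exact hS.processed (pos x - 1) (by omega) w (this.symm ▸ hx) hpos
  have hQw : ∀ i < t, Q i ≠ w := fun i hi e => by
    have := (hS.pos_queue i hi).2; rw [e] at this; omega
  have hne : ∀ v, pos v ≠ 0 → v ≠ w := fun v hv e => hv (e ▸ hpos)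
  have ep : ∀ v, v ≠ w → update pos w (t + 1) v = pos v := fun v hv => update_of_ne hv _ _
  have el : ∀ v, v ≠ w → update lev w (lev (Q h) + 1) v = lev v := fun v hv => update_of_ne hv _ _
  have er : ∀ v, v ≠ w → update par w (Q h) v = par v := fun v hv => update_of_ne hv _ _
  have eQ : ∀ i < t, update Q t w i = Q i := fun i hi => update_of_ne (by omega) _ _
  have epQ := ep _ (hQw h ht)
  have elQ := el _ (hQw h ht)
  refine ⟨by have := hS.le; omega, hS.s_le, fun i hi => ?_, fun v hv hp => ?_, fun v hv => ?_,
    fun i hi x hx => ?_,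
    fun v hv hp hl x y hxy hpx hlt => ?_, fun v hv hp hl => ?_, fun v hv hp hl => ?_,
    fun v hv hp hl x hx hpx => ?_, fun v hv v' hv' hp hp' hl hl' hle => ?_⟩
  · rcases Nat.lt_succ_iff_lt_or_eq.1 hi with hi | rfl
    · rw [eQ i hi, ep _ (hQw i hi)]
      exact hS.pos_queue i hi
    · rw [update_self, update_self]
      exact ⟨hwn, rfl⟩
  · by_cases hvw : v = w
    · subst hvw; simp
    · rw [ep v hvw] at hp ⊢
      obtain ⟨h1, h2⟩ := hS.queue_pos v hv hp
      exact ⟨by omega, by rw [eQ _ (by omega), h2]⟩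
  · have := hS.found v hv
    rwa [ep v (hne v this)]
  · rw [eQ i (by omega)] at hx
    have := hS.processed i hi x hx
    rwa [ep x (hne x this)]
  · have hvw : v ≠ w := fun e => by simp [e] at hl
    rw [ep v hvw] at hp hlt ⊢
    rw [el v hvw] at hl
    have hpt := (hS.queue_pos v hv hp).1
    have hxw : x ≠ w := fun e => by rw [e, update_self] at hlt; omega
    rw [ep x hxw] at hpx hlt
    have := hS.root v hv hp hl x y hxy hpx hlt
    rwa [ep y (hne y this.1)]
  · by_cases hvw : v = w
    · subst hvw
      rw [update_self, update_self, elQ]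
      exact ⟨hw, rfl⟩
    · rw [ep v hvw] at hp
      rw [el v hvw] at hl
      rw [er v hvw, el v hvw, el _ (hne _ (hS.pos_par v hv hp hl).1)]
      exact hS.mem_par v hv hp hl
  · by_cases hvw : v = w
    · subst hvw
      rw [update_self, update_self, epQ]
      omega
    · rw [ep v hvw] at hp
      rw [el v hvw] at hl
      rw [er v hvw, ep v hvw, ep _ (hne _ (hS.pos_par v hv hp hl).1)]
      exact hS.pos_par v hv hp hl
  · by_cases hvw : v = w
    · subst hvw
      have hxv : x ≠ v := fun e => hN.irrefl v (e ▸ hx)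
      rw [ep x hxv] at hpx ⊢
      rw [update_self, epQ, hQp]
      exact hlate x hx hpx
    · rw [ep v hvw] at hp
      rw [el v hvw] at hl
      have hpp := hS.pos_par v hv hp hl
      rw [er v hvw, ep _ (hne _ hpp.1)]
      by_cases hxw : x = w
      · rw [hxw, update_self]; omega
      · rw [ep x hxw] at hpx ⊢
        exact hS.par_le v hv hp hl x hx hpx
  · by_cases hvw : v = w <;> by_cases hvw' : v' = w
    · rw [hvw, hvw']
    · rw [ep v' hvw'] at hp' hle
      have := (hS.queue_pos v' hv' hp').1
      rw [hvw, update_self] at hle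
      omega
    · rw [ep v hvw] at hp
      rw [el v hvw] at hl
      have hpp := hS.pos_par v hv hp hl
      rw [er v hvw, ep _ (hne _ hpp.1), hvw', update_self, epQ]
      omega
    · rw [ep v hvw] at hp hle
      rw [el v hvw] at hl
      rw [ep v' hvw'] at hp' hle
      rw [el v' hvw'] at hl'
      rw [er v hvw, ep _ (hne _ (hS.pos_par v hv hp hl).1), er v' hvw',
        ep _ (hne _ (hS.pos_par v' hv' hp' hl').1)]
      exact hS.par_mono v hv v' hv' hp hp' hl hl' hle

open Function in
theorem push_root (hS : BFSState n N Q lev pos par s h h t) (ht : t ≤ h) {w : ℕ} (hwn : w < n)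
    (hN : IsAdjacency n N) (hpos : pos w = 0) :
    BFSState n N (update Q t w) (update lev w 0) (update pos w (t + 1)) par
      s h h (t + 1) := by
  have hle := hS.le
  have hclosed : ∀ x y, y ∈ N x → pos x ≠ 0 → pos y ≠ 0 := by
    intro x y hxy hpx
    obtain ⟨h1, h2⟩ := hS.queue_pos x (hN.lt _ _ hxy) hpx
    exact hS.processed (pos x - 1) (by omega) y (h2.symm ▸ hxy)
  have hQw : ∀ i < t, Q i ≠ w := fun i hi e => by
    have := (hS.pos_queue i hi).2; rw [e] at this; omega
  have hne : ∀ v, pos v ≠ 0 → v ≠ w := fun v hv e => hv (e ▸ hpos)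
  have ep : ∀ v, v ≠ w → update pos w (t + 1) v = pos v := fun v hv => update_of_ne hv _ _
  have el : ∀ v, v ≠ w → update lev w 0 v = lev v := fun v hv => update_of_ne hv _ _
  have eQ : ∀ i < t, update Q t w i = Q i := fun i hi => update_of_ne (by omega) _ _
  have hlw : ∀ v, update lev w 0 v ≠ 0 → v ≠ w := fun v hv e => by simp [e] at hv
  refine ⟨by omega, hS.s_le, fun i hi => ?_, fun v hv hp => ?_, fun v hv => ?_,
    fun i hi x hx => ?_,
    fun v hv hp hl x y hxy hpx hlt => ?_, fun v hv hp hl => ?_, fun v hv hp hl => ?_,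
    fun v hv hp hl x hx hpx => ?_, fun v hv v' hv' hp hp' hl hl' hle => ?_⟩
  · rcases Nat.lt_succ_iff_lt_or_eq.1 hi with hi | rfl
    · rw [eQ i hi, ep _ (hQw i hi)]
      exact hS.pos_queue i hi
    · rw [update_self, update_self]
      exact ⟨hwn, rfl⟩
  · by_cases hvw : v = w
    · subst hvw; simp
    · rw [ep v hvw] at hp ⊢
      obtain ⟨h1, h2⟩ := hS.queue_pos v hv hp
      exact ⟨by omega, by rw [eQ _ (by omega), h2]⟩
  · have := hS.found v hv
    rwa [ep v (hne v this)]
  · rw [eQ i (by omega)] at hx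
    have := hS.processed i hi x hx
    rwa [ep x (hne x this)]
  · by_cases hvw : v = w
    · subst hvw
      rw [update_self] at hlt ⊢
      have hxw : x ≠ v := fun e => by rw [e, update_self] at hlt; omega
      rw [ep x hxw] at hpx
      have hy := hclosed x y hxy hpx
      rw [ep y (hne y hy)]
      have := (hS.queue_pos y (hN.lt _ _ (hN.symm _ _ hxy)) hy).1
      exact ⟨hy, by omega⟩
    rw [ep v hvw] at hp hlt ⊢
    rw [el v hvw] at hl
    have hpt := (hS.queue_pos v hv hp).1
    have hxw : x ≠ w := fun e => by rw [e, update_self] at hlt; omega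
    rw [ep x hxw] at hpx hlt
    have := hS.root v hv hp hl x y hxy hpx hlt
    rwa [ep y (hne y this.1)]
  · have hvw := hlw v hl
    rw [ep v hvw] at hp
    rw [el v hvw] at hl ⊢
    rw [el _ (hne _ (hS.pos_par v hv hp hl).1)]
    exact hS.mem_par v hv hp hl
  · have hvw := hlw v hl
    rw [ep v hvw] at hp ⊢
    rw [el v hvw] at hl
    rw [ep _ (hne _ (hS.pos_par v hv hp hl).1)]
    exact hS.pos_par v hv hp hl
  · have hvw := hlw v hl
    rw [ep v hvw] at hp
    rw [el v hvw] at hl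
    have hxw : x ≠ w := fun e => by
      subst e
      exact hclosed v x (hN.symm _ _ hx) hp hpos
    rw [ep x hxw] at hpx ⊢
    rw [ep _ (hne _ (hS.pos_par v hv hp hl).1)]
    exact hS.par_le v hv hp hl x hx hpx
  · have hvw := hlw v hl
    have hvw' := hlw v' hl'
    rw [ep v hvw] at hp hle
    rw [el v hvw] at hl
    rw [ep v' hvw'] at hp' hle
    rw [el v' hvw'] at hl'
    rw [ep _ (hne _ (hS.pos_par v hv hp hl).1), ep _ (hne _ (hS.pos_par v' hv' hp' hl').1)]
    exact hS.par_mono v hv v' hv' hp hp' hl hl' hle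

theorem begin_processing (hS : BFSState n N Q lev pos par s h h t) :
    BFSState n N Q lev pos par s h (h + 1) t :=
  { hS with
    pos_par := fun v hv hp hl => by have := hS.pos_par v hv hp hl; omega }

theorem finish_processing (hS : BFSState n N Q lev pos par s h (h + 1) t) (ht : h < t)
    (hQ : ∀ w ∈ N (Q h), pos w ≠ 0) : BFSState n N Q lev pos par s (h + 1) (h + 1) t :=
  { hS with
    le := ht
    processed := fun i hi => by
      rcases Nat.lt_succ_iff_lt_or_eq.1 hi with hi | rfl
      · exact hS.processed i hi
      · exact hQ }

theorem found_succ (hS : BFSState n N Q lev pos par s h m t) (hs : s < n) (hp : pos s ≠ 0) :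
    BFSState n N Q lev pos par (s + 1) h m t :=
  { hS with
    s_le := hs
    found := fun i hi => by
      rcases Nat.lt_succ_iff_lt_or_eq.1 hi with hi | rfl
      · exact hS.found i hi
      · exact hp }

end BFSState

/-- The sum of `f` over the vertices that breadth first search still has to process. -/
def unprocessedSum (n : ℕ) (f pos : ℕ → ℕ) (h : ℕ) : ℕ :=
  ∑ v ∈ Finset.range n with pos v = 0 ∨ h < pos v, f v

theorem unprocessedSum_le {n : ℕ} {f pos pos' : ℕ → ℕ} {h : ℕ}
    (hp : ∀ w, pos w ≠ 0 → pos' w = pos w) :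
    unprocessedSum n f pos' h ≤ unprocessedSum n f pos h := by
  refine Finset.sum_le_sum_of_subset fun w hw => ?_
  simp only [Finset.mem_filter] at hw ⊢
  have := hp w
  exact ⟨hw.1, by omega⟩

theorem unprocessedSum_succ {n : ℕ} {f pos pos' : ℕ → ℕ} {h v : ℕ}
    (hp : ∀ w, pos w ≠ 0 → pos' w = pos w) (hv : v < n) (hpv : pos v = h + 1) :
    unprocessedSum n f pos' (h + 1) + f v ≤ unprocessedSum n f pos h := by
  have hmem : v ∈ (Finset.range n).filter fun v => pos v = 0 ∨ h < pos v := by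
    simp [hv, hpv]
  rw [unprocessedSum, unprocessedSum, ← Finset.sum_erase_add _ _ hmem]
  refine Nat.add_le_add_right (Finset.sum_le_sum_of_subset fun w hw => ?_) _
  simp only [Finset.mem_filter, Finset.mem_erase] at hw ⊢
  have := hp w
  refine ⟨fun e => ?_, hw.1, by omega⟩
  subst e
  omega

theorem unprocessedSum_zero_le {n : ℕ} {f pos : ℕ → ℕ} {h : ℕ} :
    unprocessedSum n f pos h ≤ ∑ v ∈ Finset.range n, f v :=
  Finset.sum_le_sum_of_subset (Finset.filter_subset _ _)

namespace Ram

attribute [simp] wp_skip_iff wp_const_iff wp_copy_iff wp_succ_iff wp_pred_iff wp_load_iff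
  wp_store_iff wp_seq_iff wp_ite_iff Memory.reg_setReg Memory.arr_setReg Memory.reg_setCell
  Memory.arr_setCell Test.Holds

/-- Append the neighbour in register `21` of the vertex in register `5` to the queue unless it has
been found before; register `7` holds its level. -/
def bfsVisit : Program :=
  .seq (.load 8 5 21) (.ite (.eq 8 30)
    (.seq (.store 2 4 21) (.seq (.succ 4 4) (.seq (.store 5 21 4)
      (.seq (.store 3 21 7) (.store 6 21 5)))))
    .skip)

/-- Process the next vertex of the queue. -/
def bfsProcess : Program :=
  .seq (.load 5 2 3) (.seq (.load 7 3 5) (.seq (.succ 7 7)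
    (.seq (forNeighbors 5 bfsVisit) (.succ 3 3))))

/-- Append the vertex in register `2` to the queue unless it has been found before. -/
def bfsRestart : Program :=
  .seq (.load 8 5 2) (.seq (.ite (.eq 8 30)
    (.seq (.store 2 4 2) (.seq (.succ 4 4) (.seq (.store 5 2 4) (.store 3 2 30)))) .skip)
    (.succ 2 2))

/-- Breadth first search. -/
def bfs : Program :=
  .loop (.lt 2 0) (.ite (.lt 3 4) bfsProcess bfsRestart)

/-- `BFSState` for the contents of the memory. -/
def BFSMemory (n : ℕ) (N : ℕ → List ℕ) (σ : Memory) (s h m : ℕ) : Prop :=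
  BFSState n N (σ.arr 2) (σ.arr 3) (σ.arr 5) (σ.arr 6) s h m (σ.reg 4)

theorem HoldsAdjacency.congr {σ τ : Memory} {n : ℕ} {N : ℕ → List ℕ} (h : HoldsAdjacency σ n N)
    (h0 : τ.arr 0 = σ.arr 0) (h1 : τ.arr 1 = σ.arr 1) : HoldsAdjacency τ n N := by
  simpa only [HoldsAdjacency, h0, h1] using h

variable {n : ℕ} {N : ℕ → List ℕ} {σ : Memory}

theorem wp_bfsProcess (hN : IsAdjacency n N) (hσ : HoldsAdjacency σ n N) (hz : σ.reg 30 = 0)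
    (hS : BFSMemory n N σ (σ.reg 2) (σ.reg 3) (σ.reg 3)) (hlt : σ.reg 3 < σ.reg 4) :
    Wp bfsProcess σ fun t τ => τ.reg 3 = σ.reg 3 + 1 ∧
      BFSMemory n N τ (σ.reg 2) (σ.reg 3 + 1) (σ.reg 3 + 1) ∧
      unprocessedSum n (fun v => 10 * (N v).length + 10) (τ.arr 5) (τ.reg 3) + t + 2 ≤
        unprocessedSum n (fun v => 10 * (N v).length + 10) (σ.arr 5) (σ.reg 3) := by
  obtain ⟨hv, hpv⟩ := hS.pos_queue _ hlt
  set v := σ.arr 2 (σ.reg 3) with hvdef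
  simp only [bfsProcess, wp_seq_iff, wp_load_iff, wp_succ_iff]
  refine (wp_forNeighbors (c := 7) (x := v) (n := n) (N := N) (fun l τ =>
    BFSMemory n N τ (σ.reg 2) (σ.reg 3) (σ.reg 3 + 1) ∧ σ.reg 3 < τ.reg 4 ∧
      τ.arr 2 (σ.reg 3) = v ∧ τ.arr 3 v = σ.arr 3 v ∧ (∀ w ∈ l, τ.arr 5 w ≠ 0) ∧
      ∀ w, σ.arr 5 w ≠ 0 → τ.arr 5 w = σ.arr 5 w)
    (hσ.congr (by simp) (by simp)) (by simp [← hvdef]) hv (by decide) (by decide) (by decide)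
    (by decide) ?_ ?_ ?_).mono ?_
  · rintro l ρ r y hr hI
    have h4 : (4 : ℕ) ≠ r := by omega
    simpa [BFSMemory, h4] using hI
  · rintro l w l' hl ρ ha hw ⟨hI, hlt', hq, hlv, hfound, hold⟩
    have hw' : w ∈ N v := by rw [hl]; simp
    have e30 : ρ.reg 30 = 0 := by
      rw [ha.reg 30 (by decide)]; simpa using hz
    have e7 : ρ.reg 7 = σ.arr 3 v + 1 := by
      rw [ha.reg 7 (by decide)]; simp [← hvdef]
    have e5 : ρ.reg 5 = v := by
      rw [ha.reg 5 (by decide)]; simp [← hvdef]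
    simp only [bfsVisit, wp_seq_iff, wp_load_iff, wp_ite_iff, wp_skip_iff]
    refine ⟨fun h0 => ?_, fun h0 => ?_⟩
    · replace h0 : ρ.arr 5 w = 0 := by simpa [hw, e30] using h0
      have hwq : w ≠ v := fun e => hN.irrefl v (e ▸ hw')
      have := BFSState.push_child hI hN hlt' (w := w) (by rw [hq]; exact hw') h0
      rw [hq, hlv] at this
      simp only [wp_store_iff, wp_succ_iff]
      refine ⟨by omega, ?_, ?_, ?_, ?_, ?_, ?_⟩
      · simpa [BFSMemory, hw, e7, e5] using this
      · simp; omega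
      · simp [Function.update_of_ne hlt'.ne, hq]
      · simp [hw, Function.update_of_ne hwq.symm, hlv]
      · intro x hx
        by_cases hxw : x = w
        · simp [hw, hxw]
        · have := hfound x (by simpa [hxw] using hx)
          simpa [hw, Function.update_of_ne hxw] using this
      · intro x hx
        have hxw : x ≠ w := fun e => by
          rw [← e, hold x hx] at h0
          exact hx h0
        simpa [hw, Function.update_of_ne hxw] using hold x hx
    · replace h0 : ρ.arr 5 w ≠ 0 := by simpa [hw, e30] using h0
      refine ⟨by omega, by simpa [BFSMemory] using hI, by simpa using hlt', by simpa using hq,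
        by simpa using hlv, ?_, by simpa using hold⟩
      intro x hx
      rcases List.mem_append.1 hx with hx | hx
      · simpa using hfound x hx
      · obtain rfl := List.mem_singleton.1 hx
        simpa using h0
  · refine ⟨by simpa [BFSMemory] using hS.begin_processing, by simpa using hlt,
      by simp [← hvdef], by simp, by simp, by simp⟩
  · rintro t τ ha ⟨ht, hI, hlt', hq, hlv, hfound, hold⟩
    have e3 : τ.reg 3 = σ.reg 3 := by
      rw [ha.reg 3 (by decide)]; simp
    have h1 := BFSState.finish_processing hI hlt' (by rw [hq]; exact hfound)
    have h2 := unprocessedSum_succ (f := fun v => 10 * (N v).length + 10) hold hv hpv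
    refine ⟨by simp [e3], by simpa [BFSMemory] using h1, ?_⟩
    simp only [Memory.reg_setReg, Memory.arr_setReg, if_true, e3]
    omega

theorem wp_bfsRestart (hN : IsAdjacency n N) (hz : σ.reg 30 = 0)
    (hS : BFSMemory n N σ (σ.reg 2) (σ.reg 3) (σ.reg 3)) (hle : σ.reg 4 ≤ σ.reg 3)
    (hs : σ.reg 2 < n) :
    Wp bfsRestart σ fun t τ => t ≤ 7 ∧ τ.reg 2 = σ.reg 2 + 1 ∧
      BFSMemory n N τ (σ.reg 2 + 1) (σ.reg 3) (σ.reg 3) ∧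
      ∀ w, σ.arr 5 w ≠ 0 → τ.arr 5 w = σ.arr 5 w := by
  simp only [bfsRestart, wp_seq_iff, wp_load_iff, wp_ite_iff, wp_skip_iff]
  refine ⟨fun h0 => ?_, fun h0 => ?_⟩
  · replace h0 : σ.arr 5 (σ.reg 2) = 0 := by simpa [hz] using h0
    have := BFSState.push_root hS hle hs hN h0
    have := this.found_succ hs (by simp)
    simp only [wp_store_iff, wp_succ_iff]
    refine ⟨by omega, by simp, by simpa [BFSMemory, hz] using this, fun w hw => ?_⟩
    have hws : w ≠ σ.reg 2 := fun e => hw (e ▸ h0)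
    simp [Function.update_of_ne hws]
  · replace h0 : σ.arr 5 (σ.reg 2) ≠ 0 := by simpa [hz] using h0
    have := hS.found_succ hs h0
    simp only [wp_succ_iff]
    exact ⟨by omega, by simp, by simpa [BFSMemory] using this, by simp⟩

theorem wp_bfs (hN : IsAdjacency n N) (hσ : HoldsAdjacency σ n N) (hn : σ.reg 0 = n)
    (hreg : ∀ r, r = 2 ∨ r = 3 ∨ r = 4 ∨ r = 30 → σ.reg r = 0) (hpos : ∀ v, σ.arr 5 v = 0) :
    Wp bfs σ fun t τ =>
      t ≤ 10 * n + ∑ v ∈ Finset.range n, (10 * (N v).length + 10) + 1 ∧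
        ∃ h m, BFSMemory n N τ n h m := by
  refine (Wp.loop (fun τ => BFSMemory n N τ (τ.reg 2) (τ.reg 3) (τ.reg 3))
    (fun τ => 10 * (n - τ.reg 2) +
      unprocessedSum n (fun v => 10 * (N v).length + 10) (τ.arr 5) (τ.reg 3)) ?_ ?_).mono ?_
  · intro ρ ha hI hb
    have e0 : ρ.reg 0 = n := (ha.reg 0 (by decide)).trans hn
    have e30 : ρ.reg 30 = 0 := (ha.reg 30 (by decide)).trans (hreg 30 (by simp))
    have hs : ρ.reg 2 < n := e0 ▸ hb
    rw [wp_ite_iff]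
    refine ⟨fun hlt => ?_, fun hlt => ?_⟩
    · refine (wp_bfsProcess hN (hσ.congr (ha.arr 0 (by decide)) (ha.arr 1 (by decide))) e30 hI
        hlt).mono fun t τ hag ⟨h1, h2, h3⟩ => ?_
      have e2 : τ.reg 2 = ρ.reg 2 := hag.reg 2 (by decide)
      exact ⟨by rw [h1, e2]; exact h2, by rw [e2]; omega⟩
    · refine (wp_bfsRestart hN e30 hI (not_lt.1 hlt) hs).mono fun t τ hag ⟨h0, h1, h2, h3⟩ => ?_
      have e3 : τ.reg 3 = ρ.reg 3 := hag.reg 3 (by decide)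
      refine ⟨by rw [h1, e3]; exact h2, ?_⟩
      have := unprocessedSum_le (n := n) (f := fun v => 10 * (N v).length + 10)
        (h := ρ.reg 3) h3
      rw [h1, e3]
      omega
  · simp only [BFSMemory, hreg 2 (by simp), hreg 3 (by simp), hreg 4 (by simp)]
    constructor <;> simp [hpos]
  · rintro t τ ha ⟨ht, hI, hb⟩
    have e0 : τ.reg 0 = n := (ha.reg 0 (by decide)).trans hn
    have e2 : τ.reg 2 = n := by
      have := hI.s_le
      simp only [Test.Holds, e0] at hb
      omega
    rw [e2] at hI
    refine ⟨?_, _, _, hI⟩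
    have := unprocessedSum_zero_le (n := n) (f := fun v => 10 * (N v).length + 10)
      (pos := σ.arr 5) (h := σ.reg 3)
    rw [hreg 2 (by simp)] at ht
    omega

end Ram

/-! ## The program: blocks of the levels -/

/-- The first position of the block of position `j`: blocks are maximal runs of vertices of the same
nonzero level, and vertices of level `0` start new blocks. -/
def blockStart (Q lev : ℕ → ℕ) : ℕ → ℕ
  | 0 => 0
  | j + 1 => if lev (Q (j + 1)) = 0 ∨ lev (Q (j + 1)) ≠ lev (Q j) then j + 1
      else blockStart Q lev j

theorem blockStart_le (Q lev : ℕ → ℕ) (j : ℕ) : blockStart Q lev j ≤ j := by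
  induction j with
  | zero => simp [blockStart]
  | succ j ih => rw [blockStart]; split_ifs <;> omega

theorem blockStart_eq (Q lev : ℕ → ℕ) {i j : ℕ} (h : blockStart Q lev j ≤ i) (hij : i ≤ j) :
    blockStart Q lev i = blockStart Q lev j := by
  induction j with
  | zero => rw [Nat.le_zero.1 hij]
  | succ j ih =>
    rcases hij.eq_or_lt with rfl | hlt
    · rfl
    · rw [blockStart] at h ⊢
      split_ifs at h ⊢ with h'
      · omega
      · exact ih h (by omega)

namespace Ram

/-- Store the block start in register `11` and initialize the other arrays. -/
def classifyStore : Program :=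
  .seq (.copy 12 7) (.seq (.store 7 5 11) (.seq (.store 4 10 5)
    (.seq (.store 9 5 10) (.store 8 10 10))))

/-- Compute the blocks (array `7`) and initialize the second numbering (array `4`), its
inverse (array `9`) and the next free position of each block (array `8`). -/
def classify : Program :=
  forUpTo 10 (.seq (.load 5 2 10) (.seq (.load 7 3 5)
    (.seq (.ite (.eq 7 30) (.copy 11 10) (.ite (.eq 7 12) .skip (.copy 11 10)))
      classifyStore)))

theorem wp_classify {n : ℕ} {σ : Memory} (hn : σ.reg 0 = n)
    (hinj : ∀ i < n, ∀ j < n, σ.arr 2 i = σ.arr 2 j → i = j) (h30 : σ.reg 30 = 0)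
    (h11 : σ.reg 11 = 0) :
    Wp classify σ fun t τ => t ≤ 12 * n + 2 ∧ ∀ j < n,
      τ.arr 7 (σ.arr 2 j) = blockStart (σ.arr 2) (σ.arr 3) j ∧ τ.arr 4 j = σ.arr 2 j ∧
      τ.arr 9 (σ.arr 2 j) = j ∧ τ.arr 8 j = j := by
  set Q := σ.arr 2 with hQ
  set lev := σ.arr 3 with hlev
  refine (wp_forUpTo (fun k τ => (∀ j < k,
      τ.arr 7 (Q j) = blockStart Q lev j ∧ τ.arr 4 j = Q j ∧
      τ.arr 9 (Q j) = j ∧ τ.arr 8 j = j) ∧ (k = 0 → τ.reg 11 = 0) ∧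
      ∀ j, k = j + 1 → τ.reg 11 = blockStart Q lev j ∧ τ.reg 12 = lev (Q j))
      (fun _ => 10) (by decide) (by decide) (by decide) ?_ ?_ ?_).mono ?_
  · intro k ρ x hI
    simpa using hI
  · rintro k hk ρ ha e10 ⟨hI, hI0, hI1⟩
    rw [hn] at hk
    have e2 : ρ.arr 2 = Q := ha.arr 2 (by decide)
    have e3 : ρ.arr 3 = lev := ha.arr 3 (by decide)
    have e30 : ρ.reg 30 = 0 := (ha.reg 30 (by decide)).trans h30
    have main : ∀ ρ' : Memory, ρ'.arr = ρ.arr → ρ'.reg 10 = k →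
        ρ'.reg 5 = Q k → ρ'.reg 7 = lev (Q k) → ρ'.reg 11 = blockStart Q lev k →
        Wp classifyStore ρ' fun t τ => t = 5 ∧
        (∀ j < k + 1, τ.arr 7 (Q j) = blockStart Q lev j ∧ τ.arr 4 j = Q j ∧
          τ.arr 9 (Q j) = j ∧ τ.arr 8 j = j) ∧ (k + 1 = 0 → τ.reg 11 = 0) ∧
          ∀ j, k + 1 = j + 1 → τ.reg 11 = blockStart Q lev j ∧ τ.reg 12 = lev (Q j) := by
      intro ρ' earr h10 h5 h7 h11'
      simp only [classifyStore, wp_seq_iff, wp_copy_iff, wp_store_iff]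
      refine ⟨trivial, fun j hj => ?_, by simp, fun j hj => ?_⟩
      · rcases Nat.lt_succ_iff_lt_or_eq.1 hj with hj | rfl
        · have hne : Q j ≠ Q k := fun e => hj.ne (hinj j (by omega) k hk e)
          simpa [earr, h5, h10, Function.update_of_ne hne, Function.update_of_ne hj.ne]
            using hI j hj
        · simp [h5, h10, h11']
      · obtain rfl : k = j := by omega
        simp [h11', h7]
    simp only [wp_seq_iff, wp_load_iff, wp_ite_iff, wp_copy_iff, wp_skip_iff]
    have hstep : (lev (Q k) = 0 → blockStart Q lev k = k) ∧ (lev (Q k) ≠ 0 →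
        (lev (Q k) = ρ.reg 12 → blockStart Q lev k = ρ.reg 11) ∧
        (lev (Q k) ≠ ρ.reg 12 → blockStart Q lev k = k)) := by
      rcases k with _ | k
      · simp [blockStart, hI0]
      · obtain ⟨e1, e2⟩ := hI1 k rfl
        rw [e1, e2, blockStart]
        grind
    refine ⟨fun h => ?_, fun h => ⟨fun h' => ?_, fun h' => ?_⟩⟩
    · refine Wp.mono (main _ (by simp; rfl) (by simp [e10]) (by simp [e10, e2])
        (by simp [e10, e2, e3]) ?_) fun t τ _ ht => ⟨by omega, ht.2⟩
      simpa [e10] using (hstep.1 (by simpa [e10, e2, e3, e30] using h)).symm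
    · have hne : lev (Q k) ≠ 0 := by simpa [e10, e2, e3, e30] using h
      refine Wp.mono (main _ (by simp; rfl) (by simp [e10]) (by simp [e10, e2])
        (by simp [e10, e2, e3]) ?_) fun t τ _ ht => ⟨by omega, ht.2⟩
      simpa [e10] using ((hstep.2 hne).1 (by simpa [e10, e2, e3, e30] using h')).symm
    · have hne : lev (Q k) ≠ 0 := by simpa [e10, e2, e3, e30] using h
      refine Wp.mono (main _ (by simp; rfl) (by simp [e10]) (by simp [e10, e2])
        (by simp [e10, e2, e3]) ?_) fun t τ _ ht => ⟨by omega, ht.2⟩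
      simpa [e10] using ((hstep.2 hne).2 (by simpa [e10, e2, e3, e30] using h')).symm
  · exact ⟨by simp, fun _ => h11, fun j hj => by omega⟩
  · rintro t τ ha ⟨ht, hI, -⟩
    rw [hn] at ht hI
    refine ⟨?_, hI⟩
    simp at ht
    omega

end Ram

/-! ## The program: numbers of neighbours in the previous level -/

/-- The number of neighbours of `v` in the previous level. -/
def backDegree (N : ℕ → List ℕ) (lev : ℕ → ℕ) (v : ℕ) : ℕ :=
  (N v).countP fun w => lev w + 1 = lev v

/-- For each `r` the vertices `v < k` with `D v = r` form a linked list in decreasing order. The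
links are increased by `1`, and `0` marks the end. -/
structure IsLinked (D : ℕ → ℕ) (k : ℕ) (first next : ℕ → ℕ) : Prop where
  first_le : ∀ r, first r ≤ k
  first_mem : ∀ r, first r ≠ 0 → D (first r - 1) = r
  lt_first : ∀ u < k, u < first (D u)
  next_le : ∀ v < k, next v ≤ v
  next_mem : ∀ v < k, next v ≠ 0 → D (next v - 1) = D v
  lt_next : ∀ v < k, ∀ u < v, D u = D v → u < next v

open Function in
theorem IsLinked.insert {D first next : ℕ → ℕ} {k : ℕ} (h : IsLinked D k first next) :
    IsLinked D (k + 1) (update first (D k) (k + 1)) (update next k (first (D k))) where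
  first_le r := by
    have := h.first_le r
    rw [update_apply]; split_ifs <;> omega
  first_mem r := by
    have := h.first_mem r
    rw [update_apply]; split_ifs with hr
    · simp [hr]
    · exact this
  lt_first u hu := by
    rw [update_apply]; split_ifs with hr
    · exact hu
    · exact h.lt_first u (lt_of_le_of_ne (Nat.le_of_lt_succ hu) fun e => hr (e ▸ rfl))
  next_le v hv := by
    rw [update_apply]; split_ifs with hr
    · subst hr; exact h.first_le _
    · exact h.next_le v (by omega)
  next_mem v hv := by
    rw [update_apply]; split_ifs with hr
    · subst hr; exact h.first_mem _
    · exact h.next_mem v (by omega)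
  lt_next v hv u hu huv := by
    rw [update_apply]; split_ifs with hr
    · subst hr; exact huv ▸ h.lt_first u hu
    · exact h.lt_next v (by omega) u hu huv

namespace Ram

/-- Compute the numbers of neighbours in the previous level (array `10`) and lists of
the vertices with the same such number (arrays `11` and `12`). -/
def countBack : Program :=
  forUpTo 10 (.seq (.const 11 0) (.seq (.load 7 3 10) (.seq
    (forNeighbors 10 (.seq (.load 8 3 21) (.seq (.succ 8 8)
      (.ite (.eq 8 7) (.succ 11 11) .skip))))
    (.seq (.store 10 10 11) (.seq (.load 8 11 11) (.seq (.store 12 10 8)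
      (.seq (.succ 8 10) (.store 11 11 8))))))))

theorem wp_countBack {n : ℕ} {N : ℕ → List ℕ} {σ : Memory} (hn : σ.reg 0 = n)
    (hσ : HoldsAdjacency σ n N) (h0 : ∀ r, σ.arr 11 r = 0) :
    Wp countBack σ fun t τ => t ≤ ∑ v ∈ Finset.range n, (7 * (N v).length + 13) + 2 ∧
      (∀ v < n, τ.arr 10 v = backDegree N (σ.arr 3) v) ∧
      IsLinked (backDegree N (σ.arr 3)) n (τ.arr 11) (τ.arr 12) := by
  set lev := σ.arr 3 with hlev
  refine (wp_forUpTo (fun k τ => (∀ v < k, τ.arr 10 v = backDegree N lev v) ∧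
      IsLinked (backDegree N lev) k (τ.arr 11) (τ.arr 12))
      (fun v => 7 * (N v).length + 11) (by decide) (by decide) (by decide) ?_ ?_ ?_).mono ?_
  · intro k ρ x hI
    simpa using hI
  · rintro k hk ρ ha e10 ⟨hI, hL⟩
    rw [hn] at hk
    have e3 : ρ.arr 3 = lev := ha.arr 3 (by decide)
    simp only [wp_seq_iff, wp_load_iff, wp_const_iff]
    refine (wp_forNeighbors (c := 4) (x := k) (n := n) (N := N)
      (fun l τ => τ.reg 11 = l.countP fun w => lev w + 1 = lev k)
      (hσ.congr (by simpa using ha.arr 0 (by decide)) (by simpa using ha.arr 1 (by decide)))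
      (by simp [e10]) hk
      (by decide) (by decide) (by decide) (by decide) ?_ ?_ ?_).mono ?_
    · rintro l ρ r y hr hI
      have h4 : (11 : ℕ) ≠ r := by omega
      simpa [h4] using hI
    · rintro l w l' hl ρ' ha' hw hI'
      have e3' : ρ'.arr 3 = lev := (ha'.arr 3 (by decide)).trans e3
      have e7 : ρ'.reg 7 = lev k := by
        rw [ha'.reg 7 (by decide)]; simp [e3, e10]
      simp only [wp_seq_iff, wp_load_iff, wp_succ_iff, wp_ite_iff, wp_skip_iff]
      refine ⟨fun h => ⟨by omega, ?_⟩, fun h => ⟨by omega, ?_⟩⟩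
      · replace h : lev w + 1 = lev k := by simpa [e3', hw, e7] using h
        simp [hI', List.countP_append, h]
      · replace h : lev w + 1 ≠ lev k := by simpa [e3', hw, e7] using h
        simp [hI', List.countP_append, h]
    · simp
    · rintro t τ ha' ⟨ht, hc⟩
      have hc' : τ.reg 11 = backDegree N lev k := hc
      have f10 : τ.reg 10 = k := by rw [ha'.reg 10 (by decide)]; simpa using e10
      have g10 : τ.arr 10 = ρ.arr 10 := by rw [ha'.arr 10 (by decide)]; simp
      have g11 : τ.arr 11 = ρ.arr 11 := by rw [ha'.arr 11 (by decide)]; simp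
      have g12 : τ.arr 12 = ρ.arr 12 := by rw [ha'.arr 12 (by decide)]; simp
      simp only [wp_store_iff, wp_succ_iff]
      refine ⟨by omega, fun v hv => ?_, ?_⟩
      · rcases Nat.lt_succ_iff_lt_or_eq.1 hv with hv | rfl
        · simpa [f10, hc', g10, Function.update_of_ne hv.ne] using hI v hv
        · simp [f10, hc']
      · simpa [f10, hc', g11, g12] using hL.insert
  · exact ⟨by simp, by constructor <;> simp [h0]⟩
  · rintro t τ ha ⟨ht, hI⟩
    rw [hn] at ht hI
    exact ⟨ht, hI⟩

end Ram

/-! ## The program: sorting the levels -/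

/-- The state of sorting each block of `Q` by decreasing `D`: `psi` is the current numbering with
inverse `ipsi`, the positions of block `c` before `ptr c` have their final contents, and the vertices
that still have to be placed are those with `D v < r`, or with `D v = r` and `v < x`. -/
structure SortState (n : ℕ) (Q cls D psi ipsi ptr : ℕ → ℕ) (r x : ℕ) : Prop where
  psi_spec : ∀ p < n, psi p < n ∧ ipsi (psi p) = p
  ipsi_spec : ∀ v < n, ipsi v < n ∧ psi (ipsi v) = v
  cls_psi : ∀ p < n, cls (psi p) = cls (Q p)
  le_ptr : ∀ v < n, cls v ≤ ptr (cls v)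
  sorted : ∀ v < n, ∀ v' < n, cls v = cls v' → ipsi v < ptr (cls v) → ipsi v < ipsi v' → D v' ≤ D v
  unplaced_iff : ∀ v < n, (D v < r ∨ D v = r ∧ v < x) ↔ ptr (cls v) ≤ ipsi v

namespace SortState

variable {n : ℕ} {Q cls D psi ipsi ptr first next : ℕ → ℕ} {r x : ℕ}

open Function in
theorem place (hS : SortState n Q cls D psi ipsi ptr r x)
    (hB : ∀ j < n, ∀ i, cls (Q j) ≤ i → i ≤ j → cls (Q i) = cls (Q j))
    (hL : IsLinked D n first next) {v : ℕ} (hv : v < n) (hx : x = v + 1) (hr : D v = r) :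
    SortState n Q cls D
      (update (update psi (ipsi v) (psi (ptr (cls v)))) (ptr (cls v)) v)
      (update (update ipsi (psi (ptr (cls v))) (ipsi v)) v (ptr (cls v)))
      (update ptr (cls v) (ptr (cls v) + 1)) r (next v) := by
  have hun : ptr (cls v) ≤ ipsi v := (hS.unplaced_iff v hv).1 (.inr ⟨hr, by omega⟩)
  obtain ⟨hq, hpq⟩ := hS.ipsi_spec v hv
  set c := cls v with hc
  set p := ptr c with hp
  set q := ipsi v with hqd
  obtain ⟨hw, hwp⟩ := hS.psi_spec p (by omega)
  set w := psi p with hwd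
  have hcp : c ≤ p := hS.le_ptr v hv
  have hQq : cls (Q q) = c := by rw [← hS.cls_psi q hq, hpq]
  have hQp : cls (Q p) = c := by rw [hB q hq p (by omega) hun, hQq]
  have hcw : cls w = c := by rw [hwd, hS.cls_psi p (by omega), hQp]
  have hpos : ∀ u < n, u ≠ v → u ≠ w → ipsi u ≠ p ∧ ipsi u ≠ q := fun u hu h1 h2 =>
    ⟨fun e => h2 (by rw [← (hS.ipsi_spec u hu).2, e]),
      fun e => h1 (by rw [← (hS.ipsi_spec u hu).2, e, hpq])⟩
  have iv : update (update ipsi w q) v p v = p := update_self _ _ _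
  have iw : w ≠ v → update (update ipsi w q) v p w = q := fun h => by
    rw [update_of_ne h, update_self]
  have iu : ∀ u, u ≠ v → u ≠ w → update (update ipsi w q) v p u = ipsi u := fun u h1 h2 => by
    rw [update_of_ne h1, update_of_ne h2]
  have hwv : w ≠ v → p ≠ q := fun h e => h (by rw [hwd, e, hpq])
  have hwv' : w = v → p = q := fun h => by rw [← hwp, h]
  refine ⟨fun j hj => ?_, fun u hu => ?_, fun j hj => ?_, fun u hu => ?_,
    fun a ha a' ha' haa hpl hlt => ?_, fun u hu => ?_⟩
  · by_cases hjp : j = p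
    · subst hjp
      rw [update_self]
      exact ⟨hv, iv⟩
    rw [update_of_ne hjp]
    by_cases hjq : j = q
    · subst hjq
      rw [update_self]
      exact ⟨hw, iw fun e => hjp (hwv' e).symm⟩
    rw [update_of_ne hjq]
    obtain ⟨h1, h2⟩ := hS.psi_spec j hj
    refine ⟨h1, ?_⟩
    rw [iu, h2]
    · intro e; rw [e] at h2; exact hjq h2.symm
    · intro e; rw [e, hwp] at h2; exact hjp h2.symm
  · by_cases huv : u = v
    · subst huv
      rw [iv, update_self]
      exact ⟨by omega, rfl⟩
    by_cases huw : u = w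
    · rw [huw] at huv ⊢
      rw [iw huv, update_of_ne (hwv huv).symm, update_self]
      exact ⟨hq, rfl⟩
    rw [iu u huv huw, update_of_ne (hpos u hu huv huw).1, update_of_ne (hpos u hu huv huw).2]
    exact hS.ipsi_spec u hu
  · by_cases hjp : j = p
    · subst hjp
      rw [update_self, hQp]
    rw [update_of_ne hjp]
    by_cases hjq : j = q
    · subst hjq
      rw [update_self, hQq, hcw]
    rw [update_of_ne hjq]
    exact hS.cls_psi j hj
  · have := hS.le_ptr u hu
    by_cases huc : cls u = c
    · rw [huc, update_self]
      omega
    · rwa [update_of_ne huc]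
  · by_cases hac : cls a = c
    · have hold : ∀ u < n, cls u = c → p ≤ ipsi u → D u ≤ r := fun u hu huc hle => by
        have := (hS.unplaced_iff u hu).2 (by rw [huc]; exact hle)
        omega
      rw [hac, update_self] at hpl
      by_cases hav : a = v
      · subst hav
        rw [iv] at hlt
        have ha'v : a' ≠ a := fun e => by rw [e, iv] at hlt; omega
        rw [hr]
        refine hold a' ha' (by rw [← haa, hac]) ?_
        by_cases ha'w : a' = w
        · rw [ha'w, hwp]
        · rw [iu a' ha'v ha'w] at hlt
          exact hlt.le
      · have haw : a ≠ w := fun e => by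
          rw [e] at hav hpl
          rw [iw hav] at hpl
          have := hwv hav
          omega
        rw [iu a hav haw] at hpl hlt
        have hap := (hpos a ha hav haw).1
        refine hS.sorted a ha a' ha' haa (by rw [hac]; omega) ?_
        by_cases ha'v : a' = v
        · rw [ha'v]; omega
        by_cases ha'w : a' = w
        · rw [ha'w, hwp]; omega
        rwa [iu a' ha'v ha'w] at hlt
    · have h1 : a ≠ v := fun e => hac (e ▸ rfl)
      have h2 : a ≠ w := fun e => hac (e ▸ hcw)
      have h3 : a' ≠ v := fun e => hac (by rw [haa, e])
      have h4 : a' ≠ w := fun e => hac (by rw [haa, e, hcw])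
      rw [update_of_ne hac, iu a h1 h2] at hpl
      rw [iu a h1 h2, iu a' h3 h4] at hlt
      exact hS.sorted a ha a' ha' haa hpl hlt
  · have hn := hL.next_le v hv
    by_cases huv : u = v
    · subst huv
      rw [iv, ← hc, update_self]
      omega
    have key : (D u < r ∨ D u = r ∧ u < next v) ↔ ptr (cls u) ≤ ipsi u := by
      rw [← hS.unplaced_iff u hu]
      refine or_congr_right (and_congr_right fun hDu => ?_)
      refine ⟨fun h => by omega, fun h => hL.lt_next v hv u (by omega) (hDu.trans hr.symm)⟩
    rw [key]
    by_cases huw : u = w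
    · rw [huw] at huv ⊢
      rw [iw huv, hcw, update_self, hwp]
      have := hwv huv
      omega
    rw [iu u huv huw]
    by_cases huc : cls u = c
    · rw [huc, update_self]
      have := (hpos u hu huv huw).1
      omega
    · rw [update_of_ne huc]

theorem next_list (hS : SortState n Q cls D psi ipsi ptr (r + 1) 0) (hL : IsLinked D n first next) :
    SortState n Q cls D psi ipsi ptr r (first r) :=
  { hS with
    unplaced_iff := fun v hv => by
      rw [← hS.unplaced_iff v hv]
      have := hL.lt_first v hv
      constructor
      · intro h; omega
      · rintro (h | h)
        · rcases Nat.lt_succ_iff_lt_or_eq.1 h with h | h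
          · exact .inl h
          · exact .inr ⟨h, h ▸ this⟩
        · omega }

end SortState

theorem card_filter_lt_add {n r x y : ℕ} {D : ℕ → ℕ} (hxy : x < y) (hx : x < n) (hr : D x = r)
    {z : ℕ} (hz : z ≤ x) :
    ((Finset.range n).filter fun v => D v = r ∧ v < z).card + 1 ≤
      ((Finset.range n).filter fun v => D v = r ∧ v < y).card := by
  refine Finset.card_lt_card (Finset.ssubset_iff_subset_ne.2 ⟨fun v hv => ?_, fun e => ?_⟩)
  · simp only [Finset.mem_filter] at hv ⊢
    exact ⟨hv.1, hv.2.1, by omega⟩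
  · have : x ∈ (Finset.range n).filter fun v => D v = r ∧ v < y := by simp [hx, hr, hxy]
    rw [← e] at this
    simp only [Finset.mem_filter] at this
    omega

theorem card_filter_lt_succ {n r y : ℕ} {D : ℕ → ℕ} :
    ((Finset.range n).filter fun v => D v < r).card +
      ((Finset.range n).filter fun v => D v = r ∧ v < y).card ≤
      ((Finset.range n).filter fun v => D v < r + 1).card := by
  rw [← Finset.card_union_of_disjoint]
  · refine Finset.card_le_card fun v hv => ?_
    simp only [Finset.mem_union, Finset.mem_filter, Finset.mem_range] at hv ⊢
    omega
  · refine Finset.disjoint_left.2 fun v hv hv' => ?_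
    simp only [Finset.mem_filter] at hv hv'
    omega

namespace Ram

/-- Swap the vertex `v`, where register `8` contains `v + 1`, with the vertex at the next free
position of its block. -/
def placeVertex : Program :=
  .seq (.pred 5 8) (.seq (.load 11 7 5) (.seq (.load 14 8 11) (.seq (.load 15 4 14)
    (.seq (.load 16 9 5) (.seq (.store 4 16 15) (.seq (.store 9 15 16) (.seq (.store 4 14 5)
      (.seq (.store 9 5 14) (.seq (.succ 14 14) (.seq (.store 8 11 14) (.load 8 12 5)))))))))))

/-- Sort all blocks by decreasing number of neighbours in the previous level. -/
def sortLevels : Program :=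
  .seq (.succ 13 0) (.loop (.lt 30 13) (.seq (.pred 13 13) (.seq (.load 8 11 13)
    (.loop (.lt 30 8) placeVertex))))

theorem wp_placeVertex {n : ℕ} {σ : Memory} {Q D first : ℕ → ℕ} {r : ℕ}
    (hB : ∀ j < n, ∀ i, σ.arr 7 (Q j) ≤ i → i ≤ j → σ.arr 7 (Q i) = σ.arr 7 (Q j))
    (hL : IsLinked D n first (σ.arr 12))
    (hS : SortState n Q (σ.arr 7) D (σ.arr 4) (σ.arr 9) (σ.arr 8) r (σ.reg 8))
    (h0 : 0 < σ.reg 8) (hle : σ.reg 8 ≤ n) (hr : D (σ.reg 8 - 1) = r) :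
    Wp placeVertex σ fun t τ => t = 12 ∧ τ.reg 8 ≤ σ.reg 8 - 1 ∧
      (0 < τ.reg 8 → D (τ.reg 8 - 1) = r) ∧
      SortState n Q (σ.arr 7) D (τ.arr 4) (τ.arr 9) (τ.arr 8) r (τ.reg 8) := by
  have := hS.place hB hL (v := σ.reg 8 - 1) (by omega) (by omega) hr
  simp only [placeVertex, wp_seq_iff, wp_pred_iff, wp_load_iff, wp_store_iff, wp_succ_iff]
  refine ⟨trivial, ?_, ?_, ?_⟩
  · simpa using hL.next_le (σ.reg 8 - 1) (by omega)
  · have := hL.next_mem (σ.reg 8 - 1) (by omega)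
    simp only [hr] at this
    simpa [Nat.pos_iff_ne_zero] using this
  · simpa using this

theorem wp_sortLevels {n : ℕ} {σ : Memory} {Q D : ℕ → ℕ} (hn : σ.reg 0 = n) (h30 : σ.reg 30 = 0)
    (hB : ∀ j < n, ∀ i, σ.arr 7 (Q j) ≤ i → i ≤ j → σ.arr 7 (Q i) = σ.arr 7 (Q j))
    (hL : IsLinked D n (σ.arr 11) (σ.arr 12))
    (hS : SortState n Q (σ.arr 7) D (σ.arr 4) (σ.arr 9) (σ.arr 8) (n + 1) 0) :
    Wp sortLevels σ fun t τ => t ≤ 17 * n + 6 ∧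
      SortState n Q (σ.arr 7) D (τ.arr 4) (τ.arr 9) (τ.arr 8) 0 0 := by
  simp only [sortLevels, wp_seq_iff, wp_succ_iff]
  refine (Wp.loop
    (fun τ => SortState n Q (σ.arr 7) D (τ.arr 4) (τ.arr 9) (τ.arr 8) (τ.reg 13) 0)
    (fun τ => 13 * ((Finset.range n).filter fun v => D v < τ.reg 13).card + 4 * τ.reg 13)
    ?_ ?_).mono ?_
  · intro ρ ha hI hb
    have e30 : ρ.reg 30 = 0 := by rw [ha.reg 30 (by decide)]; simpa using h30
    have e7 : ρ.arr 7 = σ.arr 7 := by rw [ha.arr 7 (by decide)]; simp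
    have e11 : ρ.arr 11 = σ.arr 11 := by rw [ha.arr 11 (by decide)]; simp
    have e12 : ρ.arr 12 = σ.arr 12 := by rw [ha.arr 12 (by decide)]; simp
    obtain ⟨r, hr⟩ : ∃ r, ρ.reg 13 = r + 1 := by
      have : 0 < ρ.reg 13 := by simpa [e30] using hb
      exact ⟨ρ.reg 13 - 1, by omega⟩
    rw [hr] at hI
    simp only [wp_seq_iff, wp_pred_iff, wp_load_iff]
    refine (Wp.loop (fun τ => SortState n Q (σ.arr 7) D (τ.arr 4) (τ.arr 9) (τ.arr 8) r (τ.reg 8) ∧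
        τ.reg 8 ≤ n ∧ (0 < τ.reg 8 → D (τ.reg 8 - 1) = r))
      (fun τ => 13 * ((Finset.range n).filter fun v => D v = r ∧ v < τ.reg 8).card)
      ?_ ?_).mono ?_
    · rintro ρ' ha' ⟨hI', hle, hD⟩ hb'
      have e30' : ρ'.reg 30 = 0 := by rw [ha'.reg 30 (by decide)]; simpa using e30
      have e7' : ρ'.arr 7 = σ.arr 7 := by rw [ha'.arr 7 (by decide)]; simpa using e7
      have e12' : ρ'.arr 12 = σ.arr 12 := by rw [ha'.arr 12 (by decide)]; simpa using e12
      have hpos : 0 < ρ'.reg 8 := by simpa [e30'] using hb'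
      rw [← e7'] at hB hI'
      rw [← e12'] at hL
      refine (wp_placeVertex hB hL hI' hpos hle (hD hpos)).mono fun t τ _ ⟨ht, h1, h2, h3⟩ => ?_
      have := card_filter_lt_add (n := n) (y := ρ'.reg 8) (by omega) (by omega) (hD hpos) h1
      refine ⟨⟨e7' ▸ h3, by omega, h2⟩, by omega⟩
    · refine ⟨?_, ?_, ?_⟩
      · simpa [hr, e11] using hI.next_list hL
      · simpa [hr, e11] using hL.first_le r
      · simpa [hr, e11, Nat.pos_iff_ne_zero] using hL.first_mem r
    · rintro t τ ha' ⟨ht, ⟨hI', -, -⟩, hb'⟩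
      have e30' : τ.reg 30 = 0 := by rw [ha'.reg 30 (by decide)]; simpa using e30
      have e13 : τ.reg 13 = r := by rw [ha'.reg 13 (by decide)]; simp [hr]
      have e8 : τ.reg 8 = 0 := by simpa [e30'] using hb'
      rw [e8] at hI'
      refine ⟨by rw [e13]; exact {
        hI' with unplaced_iff := fun v hv => by rw [← hI'.unplaced_iff v hv] }, ?_⟩
      rw [e13, hr]
      have := card_filter_lt_succ (n := n) (r := r) (D := D) (y := σ.arr 11 r)
      simp [hr, e11] at ht
      omega
  · simpa [hn] using hS
  · rintro t τ ha ⟨ht, hI, hb⟩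
    have e30 : τ.reg 30 = 0 := by rw [ha.reg 30 (by decide)]; simpa using h30
    have e13 : τ.reg 13 = 0 := by simpa [e30] using hb
    rw [e13] at hI
    refine ⟨?_, hI⟩
    have : ((Finset.range n).filter fun v => D v < n + 1).card ≤ n :=
      (Finset.card_filter_le _ _).trans (by simp)
    simp only [Memory.reg_setReg, if_true, hn] at ht
    omega

end Ram

/-! ## The program: testing the numbering -/

/-- Adjacency of the vertices at the positions `p` and `q` of the numbering `psi`. -/
def PositionAdj (n : ℕ) (N : ℕ → List ℕ) (psi : ℕ → ℕ) (p q : ℕ) : Prop :=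
  p < n ∧ q < n ∧ psi q ∈ N (psi p)

instance (n : ℕ) (N : ℕ → List ℕ) (psi : ℕ → ℕ) (p : ℕ) :
    DecidablePred (PositionAdj n N psi p) :=
  fun q => inferInstanceAs (Decidable (p < n ∧ q < n ∧ psi q ∈ N (psi p)))

namespace Ram

/-- Compare the neighbour in register `21`, if it lies before position `i` (register `10`), with the
values in the registers `11` and `12`, and update its entries. -/
def testVisit : Program :=
  .seq (.load 15 9 21) (.seq (.load 16 13 21) (.seq (.load 17 14 21)
    (.seq (.ite (.lt 15 10) (.seq (.ite (.eq 16 11) .skip (.const 1 0))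
      (.ite (.eq 17 12) .skip (.const 1 0))) .skip)
    (.seq (.store 13 21 14) (.seq (.succ 17 17) (.store 14 21 17))))))

/-- Test whether the numbering in array `4` is an independent module-sequence. For each vertex,
array `13` holds one more than the position of the last neighbour that has been processed (or
`0`), and array `14` the number of these neighbours. -/
def testSequence : Program :=
  .seq (.const 1 1) (forUpTo 10 (.seq (.load 5 4 10) (.seq (.load 7 13 5) (.seq (.pred 7 7)
    (.seq (.load 8 4 7) (.seq (.load 11 13 8) (.seq (.load 12 14 8) (.seq (.succ 14 10)
      (forNeighbors 5 testVisit)))))))))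

theorem wp_testVisit {σ : Memory} {P : Prop} (h1 : σ.reg 1 = 0 ∨ σ.reg 1 = 1)
    (hP : σ.reg 1 = 1 ↔ P) :
    Wp testVisit σ fun t τ => t ≤ 11 ∧ (τ.reg 1 = 0 ∨ τ.reg 1 = 1) ∧
      (τ.reg 1 = 1 ↔ P ∧ (σ.arr 9 (σ.reg 21) < σ.reg 10 →
        σ.arr 13 (σ.reg 21) = σ.reg 11 ∧ σ.arr 14 (σ.reg 21) = σ.reg 12)) ∧
      τ.arr 13 = Function.update (σ.arr 13) (σ.reg 21) (σ.reg 14) ∧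
      τ.arr 14 = Function.update (σ.arr 14) (σ.reg 21) (σ.arr 14 (σ.reg 21) + 1) := by
  have h1' : σ.reg 1 = 0 ∨ P := by rwa [hP] at h1
  simp only [testVisit, wp_seq_iff, wp_load_iff, wp_ite_iff, wp_skip_iff, wp_const_iff,
    wp_store_iff, wp_succ_iff]
  refine ⟨fun h => ⟨fun h' => ⟨fun h'' => ?_, fun h'' => ?_⟩,
    fun h' => ⟨fun h'' => ?_, fun h'' => ?_⟩⟩, fun h => ?_⟩ <;>
  simp at h
  · simp at h' h''
    simp [h1', hP, h', h'']
  · simp at h' h''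
    simp [h, h', h'']
  · simp at h' h''
    simp [h, h', h'']
  · simp at h' h''
    simp [h, h', h'']
  · simp [h1', hP, not_lt.2 h]

theorem wp_testSequence {n : ℕ} {N : ℕ → List ℕ} {σ : Memory} (hN : IsAdjacency n N)
    (hn : σ.reg 0 = n) (hσ : HoldsAdjacency σ n N)
    (hpsi : ∀ p < n, σ.arr 4 p < n ∧ σ.arr 9 (σ.arr 4 p) = p)
    (hipsi : ∀ v < n, σ.arr 9 v < n ∧ σ.arr 4 (σ.arr 9 v) = v)
    (h13 : ∀ v, σ.arr 13 v = 0) (h14 : ∀ v, σ.arr 14 v = 0) :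
    Wp testSequence σ fun t τ =>
      t ≤ ∑ p ∈ Finset.range n, (14 * (N (σ.arr 4 p)).length + 13) + 3 ∧
      (τ.reg 1 = 0 ∨ τ.reg 1 = 1) ∧
      (τ.reg 1 = 1 ↔ ∀ i < n, PassesTest (PositionAdj n N (σ.arr 4)) i) := by
  set psi := σ.arr 4 with hpsid
  set ipsi := σ.arr 9 with hipsid
  set A := PositionAdj n N psi with hA
  have hAv : ∀ v < n, ∀ i < n, A (ipsi v) i ↔ v ∈ N (psi i) := fun v hv i hi => by
    obtain ⟨h1, h2⟩ := hipsi v hv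
    simp only [hA, PositionAdj, h1, hi, h2, true_and]
    exact ⟨hN.symm _ _, hN.symm _ _⟩
  simp only [testSequence, wp_seq_iff, wp_const_iff]
  refine (wp_forUpTo (fun k τ => (τ.reg 1 = 0 ∨ τ.reg 1 = 1) ∧
      (τ.reg 1 = 1 ↔ ∀ i < k, PassesTest A i) ∧
      ∀ v < n, τ.arr 13 v = lastBefore (A (ipsi v)) k ∧ τ.arr 14 v = Nat.count (A (ipsi v)) k)
    (fun p => 14 * (N (psi p)).length + 11) (by decide) (by decide) (by decide) ?_ ?_ ?_).mono ?_
  · intro k ρ x hI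
    simpa using hI
  · rintro i hi ρ ha e10 ⟨hI, hI1, hI2⟩
    replace hi : i < n := by simpa [hn] using hi
    have e4 : ρ.arr 4 = psi := by rw [ha.arr 4 (by decide)]; simp [hpsid]
    have e9 : ρ.arr 9 = ipsi := by rw [ha.arr 9 (by decide)]; simp [hipsid]
    have g0 : ρ.arr 0 = σ.arr 0 := by rw [ha.arr 0 (by decide)]; simp
    have g1 : ρ.arr 1 = σ.arr 1 := by rw [ha.arr 1 (by decide)]; simp
    obtain ⟨hpn, hip⟩ := hpsi i hi
    set l := lastBefore (A i) i - 1 with hl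
    have hln : l < n := by
      rcases hlast : lastBefore (A i) i with _ | d
      · omega
      · have := (lastBefore_spec hlast).1; omega
    have f13 : ρ.arr 13 (psi i) = lastBefore (A i) i := by rw [(hI2 _ hpn).1, hip]
    have r13 : ρ.arr 13 (psi l) = lastBefore (A l) i := by
      rw [(hI2 _ (hpsi l hln).1).1, (hpsi l hln).2]
    have r14 : ρ.arr 14 (psi l) = Nat.count (A l) i := by
      rw [(hI2 _ (hpsi l hln).1).2, (hpsi l hln).2]
    simp only [wp_seq_iff, wp_load_iff, wp_pred_iff, wp_succ_iff]
    refine (wp_forNeighbors (c := 11) (x := psi i) (n := n) (N := N) (fun L τ =>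
      (τ.reg 1 = 0 ∨ τ.reg 1 = 1) ∧
      (τ.reg 1 = 1 ↔ (∀ j < i, PassesTest A j) ∧ ∀ b ∈ L, ipsi b < i →
        lastBefore (A (ipsi b)) i = lastBefore (A l) i ∧
        Nat.count (A (ipsi b)) i = Nat.count (A l) i) ∧
      ∀ v < n, τ.arr 13 v = (if v ∈ L then i + 1 else lastBefore (A (ipsi v)) i) ∧
        τ.arr 14 v = Nat.count (A (ipsi v)) i + if v ∈ L then 1 else 0)
      (hσ.congr (by simpa using g0) (by simpa using g1)) (by simp [e10, e4]) hpn
      (by decide) (by decide) (by decide) (by decide) ?_ ?_ ?_).mono ?_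
    · rintro L ρ r y hr hI
      have h4 : (1 : ℕ) ≠ r := by omega
      simpa [h4] using hI
    · rintro L w L' hL ρ' ha' hw ⟨hJ, hJ1, hJ2⟩
      have hwn : w < n := hN.lt _ _ (hN.symm _ _ (by rw [hL]; simp : w ∈ N (psi i)))
      have hwL : w ∉ L := fun hmem => by
        have := hN.nodup (psi i)
        rw [hL, List.nodup_append] at this
        exact this.2.2 w hmem w (by simp) rfl
      have e10' : ρ'.reg 10 = i := by rw [ha'.reg 10 (by decide)]; simpa using e10
      have e9' : ρ'.arr 9 = ipsi := by rw [ha'.arr 9 (by decide)]; simpa using e9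
      have e11' : ρ'.reg 11 = lastBefore (A l) i := by
        rw [ha'.reg 11 (by decide)]; simp [e10, e4, f13, ← hl, r13]
      have e12' : ρ'.reg 12 = Nat.count (A l) i := by
        rw [ha'.reg 12 (by decide)]; simp [e10, e4, f13, ← hl, r14]
      have e14' : ρ'.reg 14 = i + 1 := by
        rw [ha'.reg 14 (by decide)]; simp [e10]
      refine (wp_testVisit hJ hJ1).mono fun t τ _ ⟨ht, h1, h2, h3, h4⟩ => ⟨ht, h1, ?_, ?_⟩
      · rw [h2, hw, e9', e10', e11', e12', (hJ2 w hwn).1, (hJ2 w hwn).2]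
        rw [List.forall_mem_append, List.forall_mem_singleton, and_assoc, if_neg hwL, if_neg hwL,
          add_zero]
      · intro v hv
        rw [h3, h4, hw, e14', (hJ2 w hwn).2]
        by_cases hvw : v = w
        · subst hvw
          simp [hwL]
        · simpa [Function.update_of_ne hvw, hvw] using hJ2 v hv
    · refine ⟨by simpa using hI, by simpa using hI1, by simpa using hI2⟩
    · rintro t τ ha' ⟨ht, h1, h2, h3⟩
      refine ⟨by omega, h1, ?_, fun v hv => ?_⟩
      · rw [h2, Nat.forall_lt_succ_right]
        refine and_congr_right fun _ => ⟨fun h j hj hij => ?_, fun h b hb hlt => ?_⟩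
        · have := h (psi j) hij.2.2
          rw [(hpsi j hij.2.1).2] at this
          exact this hj
        · have hbn : b < n := hN.lt _ _ (hN.symm _ _ hb)
          exact h (ipsi b) hlt ⟨hi, (hipsi b hbn).1, by rw [(hipsi b hbn).2]; exact hb⟩
      · rw [lastBefore, Nat.count_succ, (h3 v hv).1, (h3 v hv).2]
        simp only [hAv v hv i hi]
        exact ⟨trivial, trivial⟩
  · refine ⟨by simp, by simp, fun v hv => by simp [h13, h14, lastBefore]⟩
  · rintro t τ ha ⟨ht, h1, h2, -⟩
    simp only [Memory.reg_setReg, hn] at ht h2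
    norm_num [add_assoc] at ht h2
    refine ⟨?_, h1, h2⟩
    omega

end Ram

/-! ## Correctness of the whole program -/

section Assembly

variable {n : ℕ}

/-- The adjacency lists as lists of natural numbers. -/
def natLists (L : Fin n → List (Fin n)) (v : ℕ) : List ℕ :=
  if h : v < n then (L ⟨v, h⟩).map Fin.val else []

theorem natLists_val (L : Fin n → List (Fin n)) (v : Fin n) :
    natLists L v = (L v).map Fin.val := by
  simp [natLists]

variable {G : SimpleGraph (Fin n)} {L : Fin n → List (Fin n)}

theorem mem_natLists (hL : IsAdjacencyLists G L) {v w : ℕ} :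
    w ∈ natLists L v ↔ ∃ (hv : v < n) (hw : w < n), G.Adj ⟨v, hv⟩ ⟨w, hw⟩ := by
  by_cases hv : v < n
  · simp only [natLists, hv, dif_pos, List.mem_map, (hL _).2, exists_true_left]
    constructor
    · rintro ⟨x, hx, rfl⟩
      exact ⟨x.2, hx⟩
    · rintro ⟨hw, h⟩
      exact ⟨_, h, rfl⟩
  · simp [natLists, hv]

theorem mem_natLists_val (hL : IsAdjacencyLists G L) {v w : Fin n} :
    (w : ℕ) ∈ natLists L v ↔ G.Adj v w := by
  simp [mem_natLists hL]

theorem IsAdjacencyLists.isAdjacency (hL : IsAdjacencyLists G L) : IsAdjacency n (natLists L) where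
  symm v w h := by
    obtain ⟨hv, hw, h⟩ := (mem_natLists hL).1 h
    exact (mem_natLists hL).2 ⟨hw, hv, h.symm⟩
  irrefl v h := by
    obtain ⟨hv, hw, h⟩ := (mem_natLists hL).1 h
    exact G.irrefl h
  lt v w h := ((mem_natLists hL).1 h).1
  nodup v := by
    unfold natLists
    split_ifs with hv
    · exact (hL _).1.map Fin.val_injective
    · exact List.nodup_nil

theorem holdsAdjacency_inputMemory (L : Fin n → List (Fin n)) :
    Ram.HoldsAdjacency (inputMemory L) n (natLists L) := by
  intro v hv
  have hlen : v < (List.ofFn L).length := by simpa using hv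
  have e0 : ∀ i ≤ n, (inputMemory L).arr 0 i = ((List.ofFn L).take i).flatten.length :=
    fun i hi => by simp [inputMemory, hi]
  have e1 : ∀ i, (inputMemory L).arr 1 i = ((List.ofFn L).flatten.map Fin.val).getD i 0 :=
    fun i => by simp [inputMemory]
  have hN : natLists L v = (L ⟨v, hv⟩).map Fin.val := by simp [natLists, hv]
  have hsplit : List.ofFn L = (List.ofFn L).take v ++ L ⟨v, hv⟩ :: (List.ofFn L).drop (v + 1) := by
    conv_lhs => rw [← List.take_append_drop v (List.ofFn L), List.drop_eq_getElem_cons hlen]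
    simp
  rw [e0 v hv.le, e0 (v + 1) hv, hN]
  refine ⟨?_, fun i hi => ?_⟩
  · rw [List.take_succ_eq_append_getElem hlen]
    simp
  · rw [List.length_map] at hi
    have hflat : (List.ofFn L).flatten = ((List.ofFn L).take v).flatten ++
        (L ⟨v, hv⟩ ++ ((List.ofFn L).drop (v + 1)).flatten) := by
      conv_lhs => rw [hsplit]
      rw [List.flatten_append, List.flatten_cons]
    rw [e1, hflat, List.map_append, List.map_append]
    rw [List.getD_append_right _ _ _ _ (by rw [List.length_map]; omega), List.length_map, Nat.add_sub_cancel_left,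
      List.getD_append _ _ _ _ (by simpa using hi), List.getD_eq_getElem _ _ (by simpa using hi)]

theorem sum_length_natLists (hL : IsAdjacencyLists G L) :
    ∑ v ∈ Finset.range n, (natLists L v).length = 2 * G.edgeSet.ncard := by
  classical
  rw [Finset.sum_range, Set.ncard_eq_toFinset_card', ← SimpleGraph.edgeFinset,
    ← SimpleGraph.sum_degrees_eq_twice_card_edges]
  refine Finset.sum_congr rfl fun v _ => ?_
  rw [natLists_val, List.length_map, ← List.toFinset_card_of_nodup (hL v).1,
    ← SimpleGraph.card_neighborFinset_eq_degree]
  congr 1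
  ext w
  simp [(hL v).2]

theorem length_natLists_le (hL : IsAdjacencyLists G L) (v : ℕ) : (natLists L v).length ≤ n := by
  rw [← List.toFinset_card_of_nodup (hL.isAdjacency.nodup v)]
  refine (Finset.card_le_card fun w hw => ?_).trans (Finset.card_range n).le
  obtain ⟨-, hw, -⟩ := (mem_natLists hL).1 (List.mem_toFinset.1 hw)
  simpa using hw

theorem backDegree_natLists (hL : IsAdjacencyLists G L) (lev : ℕ → ℕ) (v : Fin n) :
    backDegree (natLists L) lev v =
      {x : Fin n | G.Adj v x ∧ lev x + 1 = lev v}.ncard := by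
  rw [backDegree, natLists_val, List.countP_map, List.countP_eq_length_filter,
    ← List.toFinset_card_of_nodup ((hL v).1.filter _), ← Set.ncard_coe_finset]
  congr 1
  ext x
  simp [(hL v).2]

/-- A permutation of `Fin n` given by functions on the natural numbers. -/
def finPerm (f g : ℕ → ℕ) (hf : ∀ v < n, f v < n ∧ g (f v) = v) (hg : ∀ i < n, g i < n ∧ f (g i) = i) :
    Fin n ≃ Fin n where
  toFun v := ⟨f v, (hf v v.2).1⟩
  invFun i := ⟨g i, (hg i i.2).1⟩
  left_inv v := Fin.ext (hf v v.2).2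
  right_inv i := Fin.ext (hg i i.2).2

namespace BFSState

variable {Q lev pos par : ℕ → ℕ} {h m t : ℕ}

theorem length_eq {N : ℕ → List ℕ} (hS : BFSState n N Q lev pos par n h m t) : t = n := by
  have e : Fin n ≃ Fin t :=
    { toFun := fun v => ⟨pos v - 1, by
        have h1 := hS.found v v.2
        have := (hS.queue_pos v v.2 h1).1
        omega⟩
      invFun := fun i => ⟨Q i, (hS.pos_queue i i.2).1⟩
      left_inv := fun v => Fin.ext (hS.queue_pos v v.2 (hS.found v v.2)).2
      right_inv := fun i => Fin.ext (by simp [(hS.pos_queue i i.2).2]) }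
  simpa using (Fintype.card_congr e).symm

theorem isBFSTree (hL : IsAdjacencyLists G L)
    (hS : BFSState n (natLists L) Q lev pos par n h m n) {φ : Fin n ≃ Fin n}
    (hφ : ∀ v : Fin n, pos v = φ v + 1) :
    IsBFSTree G φ (fun v => lev v) fun v => if h : par v < n then ⟨par v, h⟩ else v := by
  have hN := hL.isAdjacency
  have hp : ∀ v : Fin n, pos v ≠ 0 := fun v => by rw [hφ]; omega
  have hpar : ∀ v : Fin n, lev v ≠ 0 → par v < n := fun v hv =>
    hN.lt _ _ (hS.mem_par v v.2 (hp v) hv).1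
  have hle : ∀ v w : Fin n, φ v ≤ φ w ↔ pos v ≤ pos w := fun v w => by
    rw [hφ, hφ, Fin.le_def]; omega
  have hlt : ∀ v w : Fin n, φ v < φ w ↔ pos v < pos w := fun v w => by
    rw [hφ, hφ, Fin.lt_def]; omega
  refine ⟨fun v hv x y hxy => ?_, fun v hv => ?_, fun v hv => ?_, fun v hv => ?_,
    fun v x hv hx => ?_, fun v w hv hw => ?_⟩
  · rw [hlt, hlt]
    exact fun h' => (hS.root v v.2 (hp v) hv x y ((mem_natLists_val hL).2 hxy) (hp x) h').2
  · rw [dif_pos (hpar v hv)]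
    obtain ⟨_, _, h'⟩ := (mem_natLists hL).1 (hS.mem_par v v.2 (hp v) hv).1
    exact h'
  · rw [dif_pos (hpar v hv), hlt]
    exact (hS.pos_par v v.2 (hp v) hv).2.2
  · rw [dif_pos (hpar v hv)]
    exact (hS.mem_par v v.2 (hp v) hv).2
  · rw [dif_pos (hpar v hv), hle]
    exact hS.par_le v v.2 (hp v) hv x ((mem_natLists_val hL).2 hx) (hp x)
  · rw [dif_pos (hpar v hv), dif_pos (hpar w hw), hle, hle]
    exact hS.par_mono v v.2 w w.2 (hp v) (hp w) hv hw

end BFSState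

theorem isBlockStart_of_blockStart {Q lev cls : ℕ → ℕ} {φ : Fin n ≃ Fin n}
    (hQ : ∀ v : Fin n, Q (φ v) = v) (hc : ∀ j < n, cls (Q j) = blockStart Q lev j) :
    IsBlockStart φ (fun v => lev v) fun v => cls v := by
  have hc' : ∀ v : Fin n, cls v = blockStart Q lev (φ v) := fun v => by
    rw [← hc _ (φ v).2, hQ]
  refine ⟨fun p v hpv hv hl => ?_, fun v hv => ?_⟩
  · have h1 := hQ v
    rw [hpv] at h1
    simp only [hc', hpv, blockStart, h1, hQ p]
    rw [if_neg (by simp [hv, hl])]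
  · simp only [hc']
    rcases hk : (φ v : ℕ) with _ | j
    · rfl
    · have h1 := hQ v
      rw [hk] at h1
      rw [blockStart, h1, if_pos]
      refine hv.imp_right fun ⟨p, hp, hne⟩ => ?_
      obtain rfl : (φ p : ℕ) = j := by omega
      rw [hQ p]
      exact hne.symm

theorem passesTest_iff_isIndependentModuleSequence (hL : IsAdjacencyLists G L) {psi : ℕ → ℕ}
    {ψ : Fin n ≃ Fin n} (hψ : ∀ i : Fin n, psi i = ψ.symm i) :
    (∀ i < n, PassesTest (PositionAdj n (natLists L) psi) i) ↔ IsIndependentModuleSequence G ψ := by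
  have hN := hL.isAdjacency
  have hA : ∀ a b : Fin n, PositionAdj n (natLists L) psi (ψ a) (ψ b) ↔ G.Adj a b := fun a b => by
    simp [PositionAdj, hψ, mem_natLists_val hL]
  have h1 : (∀ i < n, PassesTest (PositionAdj n (natLists L) psi) i) ↔
      ∀ i, PassesTest (PositionAdj n (natLists L) psi) i :=
    ⟨fun h i => (lt_or_ge i n).elim (h i) fun hi _ _ hij => absurd hij.1 (not_lt.2 hi),
      fun h i _ => h i⟩
  rw [h1, passesTest_iff (fun i j h => ⟨h.2.1, h.1, hN.symm _ _ h.2.2⟩)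
    (fun i h => hN.irrefl _ h.2.2), isIndependentModuleSequence_iff]
  constructor
  · intro h a b c d hb hc hd hab hac hbd
    exact (hA c d).1 (h _ _ _ _ hb hc hd ((hA a b).2 hab) ((hA a c).2 hac) ((hA b d).2 hbd))
  · intro h i j k l hj hk hl hij hik hjl
    have key : ∀ p, p < n → ∃ a, ((ψ a : Fin n) : ℕ) = p := fun p hp => ⟨ψ.symm ⟨p, hp⟩, by simp⟩
    obtain ⟨a, rfl⟩ := key i hij.1
    obtain ⟨b, rfl⟩ := key j hij.2.1
    obtain ⟨c, rfl⟩ := key k hik.2.1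
    obtain ⟨d, rfl⟩ := key l hjl.2.1
    exact (hA c d).2 (h a b c d hj hk hl ((hA a b).1 hij) ((hA a c).1 hik) ((hA b d).1 hjl))

theorem SortState.init {Q lev cls D psi ipsi ptr : ℕ → ℕ} {φ : Fin n ≃ Fin n}
    (hφ : ∀ i : Fin n, Q i = φ.symm i) (hD : ∀ v < n, D v ≤ n)
    (h : ∀ j < n, cls (Q j) = blockStart Q lev j ∧ psi j = Q j ∧ ipsi (Q j) = j ∧ ptr j = j) :
    SortState n Q cls D psi ipsi ptr (n + 1) 0 := by
  have hv : ∀ v < n, ∃ j < n, Q j = v := fun v hv =>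
    ⟨φ ⟨v, hv⟩, (φ ⟨v, hv⟩).2, by simp [hφ]⟩
  have hle : ∀ v < n, ptr (cls v) ≤ ipsi v ∧ cls v ≤ ptr (cls v) := fun v hvn => by
    obtain ⟨j, hj, rfl⟩ := hv v hvn
    have := blockStart_le Q lev j
    rw [(h j hj).1, (h j hj).2.2.1, (h _ (by omega)).2.2.2]
    exact ⟨this, le_rfl⟩
  refine ⟨fun p hp => ?_, fun v hvn => ?_, fun p hp => ?_, fun v hvn => (hle v hvn).2,
    fun v hvn v' _ _ hlt _ => absurd (hle v hvn).1 (not_le.2 hlt), fun v hvn => ?_⟩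
  · rw [(h p hp).2.1]
    exact ⟨(hφ ⟨p, hp⟩ : Q p = _) ▸ (φ.symm ⟨p, hp⟩).2, (h p hp).2.2.1⟩
  · obtain ⟨j, hj, rfl⟩ := hv v hvn
    rw [(h j hj).2.2.1, (h j hj).2.1]
    exact ⟨hj, rfl⟩
  · rw [(h p hp).2.1]
  · exact iff_of_true (.inl (Nat.lt_succ_of_le (hD v hvn))) (hle v hvn).1

namespace SortState

variable {Q lev cls psi ipsi ptr : ℕ → ℕ} {φ ψ : Fin n ≃ Fin n}

theorem lt_of_ssubset (hL : IsAdjacencyLists G L)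
    (hS : SortState n Q cls (backDegree (natLists L) lev) psi ipsi ptr 0 0)
    (hψ : ∀ v : Fin n, ipsi v = ψ v) {v w : Fin n} (hc : cls v = cls w)
    (hsub : {x : Fin n | G.Adj w x ∧ lev x + 1 = lev w} ⊂
      {x : Fin n | G.Adj v x ∧ lev x + 1 = lev v}) : ψ v < ψ w := by
  have hlt := Set.ncard_lt_ncard hsub
  rw [← backDegree_natLists hL, ← backDegree_natLists hL] at hlt
  by_contra hle
  have hne : ψ w ≠ ψ v := fun e => hlt.ne (by rw [ψ.injective e])
  have h1 : ψ w < ψ v := lt_of_le_of_ne (not_lt.1 hle) hne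
  have hpl : ¬ ptr (cls w) ≤ ipsi w := by
    rw [← hS.unplaced_iff w w.2]
    omega
  have := hS.sorted w w.2 v v.2 hc.symm (not_le.1 hpl) (by rw [hψ, hψ]; exact h1)
  omega

end SortState

end Assembly

namespace Ram

/-- The whole algorithm. -/
def recognize : Program :=
  .seq bfs (.seq classify (.seq countBack (.seq sortLevels testSequence)))

theorem wp_recognize {n : ℕ} {G : SimpleGraph (Fin n)} {L : Fin n → List (Fin n)}
    (hL : IsAdjacencyLists G L) :
    Wp recognize (inputMemory L) fun t τ =>
      t ≤ 100 * (n + G.edgeSet.ncard + 1) ∧ (τ.reg 1 = 0 ∨ τ.reg 1 = 1) ∧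
      ∃ (h m : ℕ), BFSState n (natLists L) (τ.arr 2) (τ.arr 3) (τ.arr 5) (τ.arr 6) n h m n ∧
        (∀ j < n, τ.arr 7 (τ.arr 2 j) = blockStart (τ.arr 2) (τ.arr 3) j) ∧
        SortState n (τ.arr 2) (τ.arr 7) (backDegree (natLists L) (τ.arr 3)) (τ.arr 4) (τ.arr 9)
          (τ.arr 8) 0 0 ∧
        (τ.reg 1 = 1 ↔ ∀ i < n, PassesTest (PositionAdj n (natLists L) (τ.arr 4)) i) := by
  have hN := hL.isAdjacency
  have hA := holdsAdjacency_inputMemory L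
  have hsum := sum_length_natLists hL
  have hr0 : (inputMemory L).reg 0 = n := rfl
  have hr : ∀ r, r ≠ 0 → (inputMemory L).reg r = 0 := fun r hr => if_neg hr
  have ha : ∀ a, a ≠ 0 → a ≠ 1 → ∀ i, (inputMemory L).arr a i = 0 := fun a h0 h1 i => by
    simp [inputMemory, h0, h1]
  simp only [recognize, wp_seq_iff]
  refine (wp_bfs hN hA hr0 (fun r h => hr r (by omega))
    (ha 5 (by simp) (by simp))).mono fun t₁ τ₁ a₁ ⟨ht₁, h, m, hS⟩ => ?_
  have hlen := hS.length_eq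
  rw [BFSMemory, hlen] at hS
  have hQ : ∀ i < n, τ₁.arr 5 (τ₁.arr 2 i) = i + 1 := fun i hi => (hS.pos_queue i hi).2
  refine (wp_classify (n := n) ((a₁.reg 0 (by decide)).trans hr0)
    (fun i hi j hj e => by have := hQ i hi; rw [e, hQ j hj] at this; omega)
    ((a₁.reg 30 (by decide)).trans (hr 30 (by simp)))
    ((a₁.reg 11 (by decide)).trans (hr 11 (by simp)))).mono fun t₂ τ₂ a₂ ⟨ht₂, hC⟩ => ?_
  have b₂ : Agree (.seq bfs classify) (inputMemory L) τ₂ :=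
    (a₁.weaken (by simp +contextual [Program.writesReg])
      (by simp +contextual [Program.writesArr])).trans
      (a₂.weaken (by simp +contextual [Program.writesReg])
        (by simp +contextual [Program.writesArr]))
  refine (wp_countBack (n := n) (N := natLists L) ((b₂.reg 0 (by decide)).trans hr0)
    (hA.congr (b₂.arr 0 (by decide)) (b₂.arr 1 (by decide)))
    (fun r => by rw [b₂.arr 11 (by decide)]; exact ha 11 (by simp) (by simp) r)).mono
    fun t₃ τ₃ a₃ ⟨ht₃, _, hlink⟩ => ?_
  have b₃ : Agree (.seq (.seq bfs classify) countBack) (inputMemory L) τ₃ :=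
    (b₂.weaken (by simp +contextual [Program.writesReg])
      (by simp +contextual [Program.writesArr])).trans
      (a₃.weaken (by simp +contextual [Program.writesReg])
        (by simp +contextual [Program.writesArr]))
  have e₂₂ : τ₂.arr 2 = τ₁.arr 2 := a₂.arr 2 (by decide)
  have e₂₃ : τ₂.arr 3 = τ₁.arr 3 := a₂.arr 3 (by decide)
  have e₃₄ : τ₃.arr 4 = τ₂.arr 4 := a₃.arr 4 (by decide)
  have e₃₇ : τ₃.arr 7 = τ₂.arr 7 := a₃.arr 7 (by decide)
  have e₃₈ : τ₃.arr 8 = τ₂.arr 8 := a₃.arr 8 (by decide)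
  have e₃₉ : τ₃.arr 9 = τ₂.arr 9 := a₃.arr 9 (by decide)
  have hinit : SortState n (τ₁.arr 2) (τ₃.arr 7) (backDegree (natLists L) (τ₂.arr 3)) (τ₃.arr 4)
      (τ₃.arr 9) (τ₃.arr 8) (n + 1) 0 := by
    rw [e₃₄, e₃₇, e₃₈, e₃₉]
    refine SortState.init (φ := finPerm (fun v => τ₁.arr 5 v - 1) (τ₁.arr 2)
      (fun v hv => ?_) (fun i hi => ?_)) (fun i => rfl)
      (fun v _ => List.countP_le_length.trans (length_natLists_le hL v)) hC
    · have := hS.queue_pos v hv (hS.found v hv)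
      have h0 := hS.found v hv
      exact ⟨by omega, this.2⟩
    · exact ⟨(hS.pos_queue i hi).1, by simp [hQ i hi]⟩
  refine (wp_sortLevels (n := n) (Q := τ₁.arr 2) ((b₃.reg 0 (by decide)).trans hr0)
    ((b₃.reg 30 (by decide)).trans (hr 30 (by simp))) ?_ hlink hinit).mono
    fun t₄ τ₄ a₄ ⟨ht₄, hsort⟩ => ?_
  · intro j hj i h1 h2
    rw [e₃₇, (hC j hj).1] at h1
    rw [e₃₇, (hC j hj).1, (hC i (by omega)).1]
    exact blockStart_eq _ _ h1 h2
  have b₄ : Agree (.seq (.seq (.seq bfs classify) countBack) sortLevels) (inputMemory L) τ₄ :=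
    (b₃.weaken (by simp +contextual [Program.writesReg])
      (by simp +contextual [Program.writesArr])).trans
      (a₄.weaken (by simp +contextual [Program.writesReg])
        (by simp +contextual [Program.writesArr]))
  refine (wp_testSequence hN ((b₄.reg 0 (by decide)).trans hr0)
    (hA.congr (b₄.arr 0 (by decide)) (b₄.arr 1 (by decide))) hsort.psi_spec hsort.ipsi_spec
    (fun r => by rw [b₄.arr 13 (by decide)]; exact ha 13 (by simp) (by simp) r)
    (fun r => by rw [b₄.arr 14 (by decide)]; exact ha 14 (by simp) (by simp) r)).mono
    fun t₅ τ₅ a₅ ⟨ht₅, hreg, hiff⟩ => ?_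
  have e2 : τ₅.arr 2 = τ₁.arr 2 := by
    rw [a₅.arr 2 (by decide), a₄.arr 2 (by decide), a₃.arr 2 (by decide), e₂₂]
  have e3 : τ₅.arr 3 = τ₁.arr 3 := by
    rw [a₅.arr 3 (by decide), a₄.arr 3 (by decide), a₃.arr 3 (by decide), e₂₃]
  have e5 : τ₅.arr 5 = τ₁.arr 5 := by
    rw [a₅.arr 5 (by decide), a₄.arr 5 (by decide), a₃.arr 5 (by decide), a₂.arr 5 (by decide)]
  have e6 : τ₅.arr 6 = τ₁.arr 6 := by
    rw [a₅.arr 6 (by decide), a₄.arr 6 (by decide), a₃.arr 6 (by decide), a₂.arr 6 (by decide)]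
  have e7 : τ₅.arr 7 = τ₃.arr 7 := by rw [a₅.arr 7 (by decide), a₄.arr 7 (by decide)]
  have e4 : τ₅.arr 4 = τ₄.arr 4 := a₅.arr 4 (by decide)
  have e8 : τ₅.arr 8 = τ₄.arr 8 := a₅.arr 8 (by decide)
  have e9 : τ₅.arr 9 = τ₄.arr 9 := a₅.arr 9 (by decide)
  rw [e2, e3, e4, e5, e6, e7, e8, e9]
  rw [e₂₃] at hsort
  refine ⟨?_, hreg, h, m, hS, fun j hj => by rw [e₃₇]; exact (hC j hj).1, hsort, hiff⟩
  have hperm : ∑ p ∈ Finset.range n, (natLists L (τ₄.arr 4 p)).length =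
      ∑ v ∈ Finset.range n, (natLists L v).length := by
    rw [Finset.sum_range, Finset.sum_range]
    exact Equiv.sum_comp (finPerm (τ₄.arr 4) (τ₄.arr 9) hsort.psi_spec hsort.ipsi_spec)
      fun v => (natLists L v).length
  simp only [Finset.sum_add_distrib, ← Finset.mul_sum, hperm, hsum, Finset.sum_const,
    Finset.card_range, smul_eq_mul] at ht₁ ht₃ ht₅
  omega

end Ram

theorem mainTheorem12 :
    ∃ (p : Ram.Program) (C : ℕ), ∀ (n : ℕ) (G : SimpleGraph (Fin n)) (L : Fin n → List (Fin n)),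
      IsAdjacencyLists G L →
      ∃ (t : ℕ) (τ : Ram.Memory),
        Ram.Exec p (inputMemory L) t τ ∧
        t ≤ C * (n + G.edgeSet.ncard + 1) ∧
        (τ.reg 1 = 1 ∨ τ.reg 1 = 0) ∧
        (τ.reg 1 = 1 ↔ IsIndependentModuleComposed G) ∧
        ∃ φ : Fin n ≃ Fin n,
          IsBFSNumbering G φ ∧ HoldsNumbering τ 2 φ ∧ HoldsLevels G τ 3 φ ∧
          (τ.reg 1 = 1 →
            ∃ ψ : Fin n ≃ Fin n,
              HoldsNumbering τ 4 ψ ∧ IsIndependentModuleSequence G ψ ∧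
              IsLevelRearrangement G φ ψ ∧ IsSortedByInclusion G φ ψ) := by
  refine ⟨Ram.recognize, 100, fun n G L hL => ?_⟩
  obtain ⟨t, τ, hexec, ht, hreg, h, m, hS, hC, hsort, hiff⟩ := Ram.wp_recognize hL
  have hpos : ∀ v < n, τ.arr 5 v ≠ 0 := hS.found
  set φ : Fin n ≃ Fin n := finPerm (fun v => τ.arr 5 v - 1) (τ.arr 2)
    (fun v hv => by
      have := hS.queue_pos v hv (hpos v hv)
      have h0 := hpos v hv
      exact ⟨by omega, this.2⟩)
    (fun i hi => ⟨(hS.pos_queue i hi).1, by simp [(hS.pos_queue i hi).2]⟩) with hφ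
  set ψ : Fin n ≃ Fin n := finPerm (τ.arr 9) (τ.arr 4) hsort.ipsi_spec hsort.psi_spec with hψ
  have htree := hS.isBFSTree hL (φ := φ) fun v => by
    have := hpos v v.2
    show _ = τ.arr 5 v - 1 + 1
    omega
  have hblock : IsBlockStart φ (fun v => τ.arr 3 v) fun v => τ.arr 7 v :=
    isBlockStart_of_blockStart (fun v => (hS.queue_pos v v.2 (hpos v v.2)).2) hC
  have hcls : ∀ p, τ.arr 7 (ψ.symm p) = τ.arr 7 (φ.symm p) := fun p => hsort.cls_psi p p.2
  have hstrict : ∀ v w : Fin n, G.Reachable v w → τ.arr 3 v = τ.arr 3 w →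
      {x : Fin n | G.Adj w x ∧ τ.arr 3 x + 1 = τ.arr 3 w} ⊂
        {x : Fin n | G.Adj v x ∧ τ.arr 3 x + 1 = τ.arr 3 v} → ψ v < ψ w :=
    fun v w hr hl hsub => hsort.lt_of_ssubset hL (fun _ => rfl)
      (hblock.eq_of_same_level htree hl hr) hsub
  have hims : τ.reg 1 = 1 ↔ IsIndependentModuleSequence G ψ := by
    rw [hiff]
    exact passesTest_iff_isIndependentModuleSequence hL fun _ => rfl
  refine ⟨t, τ, hexec, ht, hreg.symm, ?_, φ, htree.isBFSNumbering, fun _ => rfl,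
    fun u hu k v hv => ((htree.mem_levelSet_iff hu).1 hv).2, fun h1 => ⟨ψ, fun _ => rfl,
      hims.1 h1, hblock.isLevelRearrangement htree hcls,
      IsBlockStart.isSortedByInclusion htree hstrict⟩⟩
  rw [hims]
  constructor
  · intro hseq
    refine ⟨ψ.trans (finCongr (Fintype.card_fin n).symm), fun v hv => ?_⟩
    exact hseq v hv
  · rintro ⟨χ, hχ⟩
    exact htree.isIndependentModuleSequence_of_sorted hχ.isTwinOrder
      (fun x y hxy hl => hblock.lt_of_lev_lt htree hcls hxy hl) hstrict
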